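/- Let $\mathbb D$ be the open unit disk, $H(\mathbb D)$ the space of analytic functions on $\mathbb D$, and $dA$ the Lebesgue area measure on $\mathbb D$ normalized so that $A(\mathbb D)=1$. For $\alpha\in\mathbb R$ and $f\in H(\mathbb D)$ put \[\|f\|_{\mathfrak B^1_{\log^\alpha}}=|f(0)|+\int_{\mathbb D}|f'(z)|\,\log^\alpha\frac{2}{1-|z|}\,dA(z)\in[0,\infty],\] and let $\mathfrak B^1_{\log^\alpha}$ be the set of all $f\in H(\mathbb D)$ for which this quantity is finite. For $g\in H(\mathbb D)$, $g(z)=\sum_{n\ge 0}\hat g(n)z^n$, the Libera transform of $g$ is \[\Lambda g(z)=\frac1{1-z}\int_z^1 g(\zeta)\,d\zeta=\int_0^1 g(t+(1-t)z)\,dt=\lim_{x\uparrow1}\int_0^x g(t+(1-t)z)\,dt,\qquad z\in\mathbb D,\] where the first integral is taken along the segment from $z$ to $1$; $\Lambda g$ is said to be well defined if this limit exists for every $z\in\mathbb D$. Theorem. Let $\alpha>-1$. There is a constant $C>0$, depending only on $\alpha$, such that the following holds for every $g\in H(\mathbb D)$ all of whose Taylor coefficients $\hat g(n)$ are real and nonnegative.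 Put \[K_\alpha(g)=\sum_{n=0}^\infty\frac{\hat g(n)\,\log^{\alpha+1}(n+2)}{n+1}\in[0,\infty].\] Then $\Lambda g$ is well defined and belongs to $\mathfrak B^1_{\log^\alpha}$ if and only if $K_\alpha(g)<\infty$. Moreover, whenever $\Lambda g$ is well defined, \[K_\alpha(g)/C\le\|\Lambda g\|_{\mathfrak B^1_{\log^\alpha}}\le C\,K_\alpha(g)\] (as an inequality in $[0,\infty]$). -/

import Mathlib

open Set Filter Topology MeasureTheory
open scoped ENNReal

namespace LogBloch

/-- The open unit disk of the complex plane. -/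
def unitDisk : Set ℂ := Metric.ball (0 : ℂ) 1

/-- Normalized Lebesgue measure on the unit disk. -/
noncomputable def diskArea : Measure ℂ :=
  (ENNReal.ofReal Real.pi)⁻¹ • (volume : Measure ℂ).restrict unitDisk

/-- The `n`-th Taylor coefficient of `g` at the origin. -/
noncomputable def taylorCoeff (g : ℂ → ℂ) (n : ℕ) : ℂ :=
  iteratedDeriv n g 0 / (n.factorial : ℂ)

/-- The (extended) norm `|f(0)| + ∫ |f'(z)| log^α (2 / (1 - |z|)) dA(z)`, with values in
`[0, ∞]`. -/
noncomputable def bloch1Norm (α : ℝ) (f : ℂ → ℂ) : ℝ≥0∞ :=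
  ‖f 0‖ₑ + ∫⁻ z, ‖deriv f z‖ₑ * ENNReal.ofReal (Real.log (2 / (1 - ‖z‖)) ^ α) ∂diskArea

/-- Membership in the space of analytic functions on the disk with finite norm `bloch1Norm α`. -/
def MemBloch1 (α : ℝ) (f : ℂ → ℂ) : Prop :=
  AnalyticOnNhd ℂ f unitDisk ∧ bloch1Norm α f < ⊤

/-- The truncated integral `∫_0^x g (t + (1 - t) z) dt`. For `x ↑ 1` it tends to
`∫_0^1 g (t + (1 - t) z) dt`, i.e. to `(1 - z)⁻¹ ∫_z^1 g (ζ) dζ` along the segment from `z`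
to `1`. -/
noncomputable def liberaTrunc (g : ℂ → ℂ) (z : ℂ) (x : ℝ) : ℂ :=
  ∫ t in (0 : ℝ)..x, g ((t : ℂ) + (1 - (t : ℂ)) * z)

/-- The Libera transform of `g` is well defined: the integral `∫_0^1 g (t + (1 - t) z) dt`
exists (as a limit for `x ↑ 1`) for every `z` in the disk. -/
def LiberaExists (g : ℂ → ℂ) : Prop :=
  ∀ z ∈ unitDisk, ∃ w : ℂ, Tendsto (liberaTrunc g z) (𝓝[<] (1 : ℝ)) (𝓝 w)

/-- The Libera transform `z ↦ ∫_0^1 g (t + (1 - t) z) dt` (meaningful on the disk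
when `LiberaExists g`). -/
noncomputable def libera (g : ℂ → ℂ) (z : ℂ) : ℂ :=
  limUnder (𝓝[<] (1 : ℝ)) (liberaTrunc g z)

/-- `K_α(g) = ∑ ĝ(n) log^{α+1}(n+2) / (n+1)` as an element of `[0, ∞]`, for `g` with real
nonnegative Taylor coefficients. -/
noncomputable def coeffSum (α : ℝ) (g : ℂ → ℂ) : ℝ≥0∞ :=
  ∑' n : ℕ, ENNReal.ofReal
    ((taylorCoeff g n).re * Real.log ((n : ℝ) + 2) ^ (α + 1) / ((n : ℝ) + 1))

end LogBloch

namespace LogBloch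

/-! Put c n = ĝ(n)/(n+1), so that P(z) = ∑ c n z^(n+1) is a primitive of g. The truncated Libera
integral equals (P(x+(1-x)z) - P(z))/(1-z). At z = 0 it is P(x), so nonnegativity of the c n makes
its limit as x ↑ 1 exist exactly when ∑ c n converges. In that case P is continuous on the closed
disk, and dividing 1 - z^(n+1) by 1 - z gives Λg = ∑ c n G_n with G_n = 1 + z + ⋯ + z^n
(`libera_eq_geomSeries`). Both estimates thereby reduce to single polynomials G_n.

Upper bound: by the triangle inequality it suffices that the weighted area integral of |G_n'| is
O(log^(α+1)(n+2)) (`exists_lintegral_deriv_geomPoly_le`). For r < 1 - 1/(n+1) the circular integral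
of |G_n'| is at most of order 1/(1-r) + (n+1) r^n log(2/(1-r)); closer to the circle it is at most
of order (n+1) log(2/(1-r)). Integration of log^α(2/(1-r))/(1-r) raises the exponent to α+1, and
this is where α > -1 enters.

Lower bound: the Hardy-type inequality `two_mul_norm_sub_le` controls |f(r) - f(0)| by the circular
integral of |f'|. For f = ∑ c n G_n and real r nothing cancels, since f(r) - f(0) = ∑ c n (G_n(r) -
1) has nonnegative terms, and Tonelli again isolates each n. On [1/2, 1-1/n] one has G_n(r) - 1 ≥
1/(4(1-r)), which yields log^(α+1)(n+2) up to a constant; f(0) = ∑ c n pays for that constant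
(`exists_log_rpow_le_lintegral`). -/

/-- The geometric polynomial `1 + z + ⋯ + z ^ n`. -/
noncomputable def geomPoly (n : ℕ) (z : ℂ) : ℂ := ∑ k ∈ Finset.range (n + 1), z ^ k

/-! ### Pointwise bounds for geometric polynomials and their derivatives -/

theorem mem_unitDisk {z : ℂ} : z ∈ unitDisk ↔ ‖z‖ < 1 := by
  simp [unitDisk]

theorem isOpen_unitDisk : IsOpen unitDisk := Metric.isOpen_ball

theorem one_sub_ne_zero_of_norm_lt_one {z : ℂ} (hz : ‖z‖ < 1) : 1 - z ≠ 0 := by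
  intro h
  rw [← sub_eq_zero.1 h] at hz
  simp at hz

theorem differentiable_geomPoly (n : ℕ) : Differentiable ℂ (geomPoly n) := by
  unfold geomPoly
  fun_prop

theorem geomPoly_zero_right (n : ℕ) : geomPoly n 0 = 1 := by
  simp [geomPoly, Finset.sum_range_succ']

theorem one_sub_mul_geomPoly (n : ℕ) (z : ℂ) : (1 - z) * geomPoly n z = 1 - z ^ (n + 1) :=
  mul_neg_geom_sum z (n + 1)

theorem norm_geomPoly_le_inv (n : ℕ) {z : ℂ} {r : ℝ} (hz : ‖z‖ ≤ r) (hr : r < 1) :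
    ‖geomPoly n z‖ ≤ (1 - r)⁻¹ := by
  have hr0 : 0 ≤ r := (norm_nonneg z).trans hz
  calc ‖geomPoly n z‖ ≤ ∑ k ∈ Finset.range (n + 1), ‖z ^ k‖ := norm_sum_le _ _
    _ ≤ ∑ k ∈ Finset.range (n + 1), r ^ k := by
        gcongr with k
        rw [norm_pow]
        gcongr
    _ ≤ ∑' k : ℕ, r ^ k :=
        (summable_geometric_of_lt_one hr0 hr).sum_le_tsum _ fun k _ => by positivity
    _ = (1 - r)⁻¹ := tsum_geometric_of_lt_one hr0 hr

theorem norm_geomPoly_le_add_one (n : ℕ) {z : ℂ} (hz : ‖z‖ ≤ 1) : ‖geomPoly n z‖ ≤ n + 1 := by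
  calc ‖geomPoly n z‖ ≤ ∑ k ∈ Finset.range (n + 1), ‖z ^ k‖ := norm_sum_le _ _
    _ ≤ ∑ k ∈ Finset.range (n + 1), (1 : ℝ) := by
        gcongr with k
        rw [norm_pow]
        exact pow_le_one₀ (norm_nonneg _) hz
    _ = n + 1 := by simp

theorem one_sub_mul_deriv_geomPoly (n : ℕ) (z : ℂ) :
    (1 - z) * deriv (geomPoly n) z = geomPoly n z - (n + 1) * z ^ n := by
  have h1 : HasDerivAt (fun w => (1 - w) * geomPoly n w)
      (-1 * geomPoly n z + (1 - z) * deriv (geomPoly n) z) z :=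
    ((hasDerivAt_id z).const_sub 1).mul (differentiable_geomPoly n z).hasDerivAt
  have h2 : HasDerivAt (fun w => (1 - w) * geomPoly n w) (-(((n + 1 : ℕ) : ℂ) * z ^ n)) z := by
    simp_rw [one_sub_mul_geomPoly]
    simpa using (hasDerivAt_pow (n + 1) z).const_sub 1
  have h := h1.unique h2
  push_cast at h
  linear_combination h

/-- Both terms of (1-z)G_n' = G_n - (n+1)z^n are at most n+1 in modulus. This bound serves the
annulus 1 - |z| < 1/(n+1). -/
theorem norm_deriv_geomPoly_le_div (n : ℕ) {z : ℂ} (hz : ‖z‖ < 1) :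
    ‖deriv (geomPoly n) z‖ ≤ 2 * (n + 1) / ‖1 - z‖ := by
  have h0 : 0 < ‖1 - z‖ := norm_pos_iff.2 (one_sub_ne_zero_of_norm_lt_one hz)
  rw [le_div_iff₀ h0, mul_comm, ← norm_mul, one_sub_mul_deriv_geomPoly]
  refine (norm_sub_le _ _).trans ?_
  have h1 := norm_geomPoly_le_add_one n hz.le
  have h2 : ‖((n : ℂ) + 1) * z ^ n‖ ≤ n + 1 := by
    have : ‖(n : ℂ) + 1‖ = n + 1 := by
      exact_mod_cast Complex.norm_natCast (n + 1)
    rw [norm_mul, norm_pow, this]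
    exact mul_le_of_le_one_right (by positivity) (pow_le_one₀ (norm_nonneg _) hz.le)
  linarith

/-- The same identity, now with |G_n| ≤ 2/|1-z| and the decay of |z|^n retained. This bound serves
radii below 1 - 1/(n+1), where a factor n+1 without decay would be too costly. -/
theorem norm_deriv_geomPoly_le_add (n : ℕ) {z : ℂ} (hz : ‖z‖ < 1) :
    ‖deriv (geomPoly n) z‖ ≤ 2 / ‖1 - z‖ ^ 2 + (n + 1) * ‖z‖ ^ n / ‖1 - z‖ := by
  have h0 : 0 < ‖1 - z‖ := norm_pos_iff.2 (one_sub_ne_zero_of_norm_lt_one hz)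
  have h1 : ‖geomPoly n z‖ ≤ 2 / ‖1 - z‖ := by
    rw [le_div_iff₀ h0, mul_comm, ← norm_mul, one_sub_mul_geomPoly]
    refine (norm_sub_le _ _).trans ?_
    have : ‖z ^ (n + 1)‖ ≤ 1 := by
      rw [norm_pow]
      exact pow_le_one₀ (norm_nonneg _) hz.le
    simp only [norm_one]
    linarith
  have h2 : ‖((n : ℂ) + 1) * z ^ n‖ = (n + 1) * ‖z‖ ^ n := by
    have : ‖(n : ℂ) + 1‖ = n + 1 := by
      exact_mod_cast Complex.norm_natCast (n + 1)
    rw [norm_mul, norm_pow, this]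
  have h3 : ‖1 - z‖ * ‖deriv (geomPoly n) z‖ ≤ 2 / ‖1 - z‖ + (n + 1) * ‖z‖ ^ n := by
    rw [← norm_mul, one_sub_mul_deriv_geomPoly, ← h2]
    exact (norm_sub_le _ _).trans (by gcongr)
  have h4 : 2 / ‖1 - z‖ ^ 2 + (n + 1) * ‖z‖ ^ n / ‖1 - z‖ =
      (2 / ‖1 - z‖ + (n + 1) * ‖z‖ ^ n) / ‖1 - z‖ := by
    field_simp
  rw [h4, le_div_iff₀ h0, mul_comm]
  exact h3

/-! ### The primitive of a power series and the Libera transform -/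

/-- The power series `∑ c n * z ^ (n + 1)`. -/
noncomputable def primitiveSeries (c : ℕ → ℝ) (z : ℂ) : ℂ := ∑' n, (c n : ℂ) * z ^ (n + 1)

/-- The series `∑ c n * (1 + z + ⋯ + z ^ n)`. -/
noncomputable def geomSeries (c : ℕ → ℝ) (z : ℂ) : ℂ := ∑' n, (c n : ℂ) * geomPoly n z

/-- `c` are the nonnegative coefficients of the primitive of `g`. -/
structure IsPrimitiveCoeff (g : ℂ → ℂ) (c : ℕ → ℝ) : Prop where
  nonneg : ∀ n, 0 ≤ c n
  hasSum : ∀ z ∈ unitDisk, HasSum (fun n : ℕ => ((c n * (n + 1) : ℝ) : ℂ) * z ^ n) (g z)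

theorem isPrimitiveCoeff_taylorCoeff {g : ℂ → ℂ} (hg : AnalyticOnNhd ℂ g unitDisk)
    (h : ∀ n : ℕ, (taylorCoeff g n).im = 0 ∧ 0 ≤ (taylorCoeff g n).re) :
    IsPrimitiveCoeff g fun n => (taylorCoeff g n).re / (n + 1) where
  nonneg n := div_nonneg (h n).2 (by positivity)
  hasSum z hz := by
    have h1 := Complex.hasSum_taylorSeries_on_ball (c := 0) (r := 1) hg.differentiableOn hz
    refine (congrArg (fun f => HasSum f _) (funext fun n => ?_)).mpr h1
    have h2 : (((taylorCoeff g n).re : ℝ) : ℂ) = taylorCoeff g n :=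
      Complex.ext (by simp) (by simp [(h n).1])
    have h3 : ((n : ℝ) + 1) ≠ 0 := by positivity
    rw [div_mul_cancel₀ _ h3, h2, taylorCoeff, sub_zero]
    simp only [smul_eq_mul]
    ring

namespace IsPrimitiveCoeff

variable {g : ℂ → ℂ} {c : ℕ → ℝ}

theorem summable_pow (h : IsPrimitiveCoeff g c) {r : ℝ} (h0 : 0 ≤ r) (h1 : r < 1) :
    Summable fun n : ℕ => c n * (n + 1) * r ^ n := by
  have hr : (r : ℂ) ∈ unitDisk := by simpa [mem_unitDisk, abs_of_nonneg h0] using h1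
  have := (h.hasSum _ hr).summable
  exact_mod_cast this

/-- The majorant is the series of g itself at the radius r, so summability comes for free from
`summable_pow`. -/
theorem norm_term_le (h : IsPrimitiveCoeff g c) {r : ℝ} (h1 : r < 1) (n : ℕ) {w : ℂ}
    (hw : ‖w‖ ≤ r) : ‖(c n : ℂ) * w ^ (n + 1)‖ ≤ c n * (n + 1) * r ^ n := by
  have h0 : 0 ≤ r := (norm_nonneg w).trans hw
  rw [norm_mul, norm_pow, Complex.norm_real, Real.norm_of_nonneg (h.nonneg n), mul_assoc]
  refine mul_le_mul_of_nonneg_left ?_ (h.nonneg n)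
  calc ‖w‖ ^ (n + 1) ≤ r ^ (n + 1) := by gcongr
    _ ≤ r ^ n := pow_le_pow_of_le_one h0 h1.le (Nat.le_succ n)
    _ ≤ (n + 1) * r ^ n := le_mul_of_one_le_left (by positivity) (by simp)

theorem hasDerivAt_primitiveSeries (h : IsPrimitiveCoeff g c) {z : ℂ} (hz : ‖z‖ < 1) :
    HasDerivAt (primitiveSeries c) (g z) z := by
  obtain ⟨r, hzr, hr⟩ := exists_between hz
  have h0 : 0 ≤ r := (norm_nonneg z).trans hzr.le
  have hzb : z ∈ Metric.ball (0 : ℂ) r := by simpa using hzr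
  have hd : ∀ n : ℕ, DifferentiableOn ℂ (fun w : ℂ => (c n : ℂ) * w ^ (n + 1))
      (Metric.ball (0 : ℂ) r) := fun n => by fun_prop
  have hb : ∀ n : ℕ, ∀ w ∈ Metric.ball (0 : ℂ) r,
      ‖(c n : ℂ) * w ^ (n + 1)‖ ≤ c n * (n + 1) * r ^ n := fun n w hw =>
    h.norm_term_le hr n (by simpa using (Metric.mem_ball.1 hw).le)
  have h1 := Complex.hasSum_deriv_of_summable_norm (h.summable_pow h0 hr) hd
    Metric.isOpen_ball hb hzb
  have h2 := (Complex.differentiableOn_tsum_of_summable_norm (h.summable_pow h0 hr) hd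
    Metric.isOpen_ball hb).differentiableAt (Metric.isOpen_ball.mem_nhds hzb)
  have h3 : deriv (primitiveSeries c) z = g z := by
    refine h1.unique ?_
    refine (congrArg (fun f => HasSum f _) (funext fun n => ?_)).mpr (h.hasSum z (mem_unitDisk.2 hz))
    rw [((hasDerivAt_pow (n + 1) z).const_mul (c n : ℂ)).deriv]
    push_cast
    ring
  rw [← h3]
  exact h2.hasDerivAt

theorem norm_segment_lt_one {z : ℂ} (hz : ‖z‖ < 1) {t : ℝ} (h0 : 0 ≤ t) (h1 : t < 1) :
    ‖(t : ℂ) + (1 - (t : ℂ)) * z‖ < 1 := by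
  have h2 : ‖(1 : ℂ) - t‖ = 1 - t := by
    rw [← Complex.ofReal_one, ← Complex.ofReal_sub, Complex.norm_real,
      Real.norm_of_nonneg (by linarith)]
  calc _ ≤ ‖(t : ℂ)‖ + ‖(1 - (t : ℂ)) * z‖ := norm_add_le _ _
    _ = t + (1 - t) * ‖z‖ := by
        rw [norm_mul, h2, Complex.norm_real, Real.norm_of_nonneg h0]
    _ < 1 := by nlinarith

theorem continuousOn (h : IsPrimitiveCoeff g c) : ContinuousOn g unitDisk := by
  have h1 : DifferentiableOn ℂ (primitiveSeries c) unitDisk := fun z hz =>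
    (h.hasDerivAt_primitiveSeries (mem_unitDisk.1 hz)).differentiableAt.differentiableWithinAt
  refine (h1.deriv isOpen_unitDisk).continuousOn.congr fun z hz => ?_
  exact (h.hasDerivAt_primitiveSeries (mem_unitDisk.1 hz)).deriv.symm

theorem liberaTrunc_eq (h : IsPrimitiveCoeff g c) {z : ℂ} (hz : ‖z‖ < 1) {x : ℝ}
    (h0 : 0 ≤ x) (h1 : x < 1) :
    liberaTrunc g z x =
      (primitiveSeries c (x + (1 - x) * z) - primitiveSeries c z) / (1 - z) := by
  have hmem : ∀ t ∈ uIcc 0 x, ‖(t : ℂ) + (1 - (t : ℂ)) * z‖ < 1 := fun t ht => by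
    rw [uIcc_of_le h0] at ht
    exact norm_segment_lt_one hz ht.1 (ht.2.trans_lt h1)
  have hd : ∀ t ∈ uIcc 0 x, HasDerivAt
      (fun t : ℝ => primitiveSeries c ((t : ℂ) + (1 - (t : ℂ)) * z))
      (g ((t : ℂ) + (1 - (t : ℂ)) * z) * (1 - z)) t := fun t ht => by
    have hin : HasDerivAt (fun t : ℝ => (t : ℂ) + (1 - (t : ℂ)) * z) (1 + (-1) * z) t :=
      (hasDerivAt_id t).ofReal_comp.add
        (((hasDerivAt_id t).ofReal_comp.const_sub 1).mul_const z)
    have := (h.hasDerivAt_primitiveSeries (hmem t ht)).comp_of_eq t hin rfl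
    refine this.congr_deriv ?_
    ring
  have hc : ContinuousOn (fun t : ℝ => g ((t : ℂ) + (1 - (t : ℂ)) * z) * (1 - z))
      (uIcc 0 x) := by
    refine ContinuousOn.mul (h.continuousOn.comp (by fun_prop) fun t ht => ?_) continuousOn_const
    exact mem_unitDisk.2 (hmem t ht)
  have := intervalIntegral.integral_eq_sub_of_hasDerivAt hd hc.intervalIntegrable
  rw [intervalIntegral.integral_mul_const] at this
  rw [eq_div_iff (one_sub_ne_zero_of_norm_lt_one hz), liberaTrunc, this]
  simp

/-- At z = 0 the truncated integral is ∑ c n x^(n+1). By positivity it dominates each of its partial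
sums; letting x ↑ 1 bounds the partial sums of c by the real part of the limit. -/
theorem summable_of_liberaExists (h : IsPrimitiveCoeff g c) (hL : LiberaExists g) :
    Summable c := by
  obtain ⟨w, hw⟩ := hL 0 (by simp [mem_unitDisk])
  have hre : Tendsto (fun x : ℝ => (liberaTrunc g 0 x).re) (𝓝[<] 1) (𝓝 w.re) :=
    (Complex.continuous_re.tendsto w).comp hw
  refine summable_of_sum_range_le (c := w.re) h.nonneg fun m => ?_
  have hl : Tendsto (fun x : ℝ => ∑ i ∈ Finset.range m, c i * x ^ (i + 1)) (𝓝[<] 1)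
      (𝓝 (∑ i ∈ Finset.range m, c i)) := by
    have : Continuous fun x : ℝ => ∑ i ∈ Finset.range m, c i * x ^ (i + 1) := by fun_prop
    simpa using (this.tendsto 1).mono_left nhdsWithin_le_nhds
  refine le_of_tendsto_of_tendsto hl hre ?_
  filter_upwards [Ioo_mem_nhdsLT (zero_lt_one' ℝ)] with x hx
  have hs : Summable fun n : ℕ => c n * x ^ (n + 1) := by
    refine Summable.of_nonneg_of_le (fun n => mul_nonneg (h.nonneg n) (pow_nonneg hx.1.le _))
      (fun n => ?_) (h.summable_pow hx.1.le hx.2)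
    have := h.norm_term_le hx.2 n (w := (x : ℂ)) (by simp [abs_of_nonneg hx.1.le])
    refine le_trans (le_of_eq ?_) this
    rw [norm_mul, norm_pow, Complex.norm_real, Complex.norm_real,
      Real.norm_of_nonneg (h.nonneg n), Real.norm_of_nonneg hx.1.le]
  have h2 : primitiveSeries c x = ((∑' n : ℕ, c n * x ^ (n + 1) : ℝ) : ℂ) := by
    rw [primitiveSeries, Complex.ofReal_tsum]
    push_cast
    rfl
  have h3 : primitiveSeries c 0 = 0 := by simp [primitiveSeries]
  rw [h.liberaTrunc_eq (by simp) hx.1.le hx.2, mul_zero, add_zero, h2, h3, sub_zero, sub_zero,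
    div_one, Complex.ofReal_re]
  exact hs.sum_le_tsum _ fun n _ => mul_nonneg (h.nonneg n) (pow_nonneg hx.1.le _)

theorem continuousOn_primitiveSeries (h0 : ∀ n, 0 ≤ c n) (hs : Summable c) :
    ContinuousOn (primitiveSeries c) (Metric.closedBall 0 1) := by
  refine continuousOn_tsum (fun n => by fun_prop) hs fun n w hw => ?_
  rw [norm_mul, norm_pow, Complex.norm_real, Real.norm_of_nonneg (h0 n)]
  exact mul_le_of_le_one_right (h0 n) (pow_le_one₀ (norm_nonneg _) (by simpa using hw))

theorem geomSeries_eq (h0 : ∀ n, 0 ≤ c n) (hs : Summable c) {z : ℂ} (hz : ‖z‖ < 1) :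
    (primitiveSeries c 1 - primitiveSeries c z) / (1 - z) = geomSeries c z := by
  have hsum : ∀ w : ℂ, ‖w‖ ≤ 1 → Summable fun n => (c n : ℂ) * w ^ (n + 1) := fun w hw => by
    refine Summable.of_norm_bounded hs fun n => ?_
    rw [norm_mul, norm_pow, Complex.norm_real, Real.norm_of_nonneg (h0 n)]
    exact mul_le_of_le_one_right (h0 n) (pow_le_one₀ (norm_nonneg _) hw)
  rw [primitiveSeries, primitiveSeries, ← (hsum 1 (by simp)).tsum_sub (hsum z hz.le),
    ← tsum_div_const, geomSeries]
  refine tsum_congr fun n => ?_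
  rw [div_eq_iff (one_sub_ne_zero_of_norm_lt_one hz)]
  linear_combination (-(c n : ℂ)) * one_sub_mul_geomPoly n z

/-- The segment from z to 1 stays in the closed disk, on which the primitive is continuous once c is
summable. -/
theorem tendsto_liberaTrunc (h : IsPrimitiveCoeff g c) (hs : Summable c) {z : ℂ}
    (hz : ‖z‖ < 1) : Tendsto (liberaTrunc g z) (𝓝[<] 1) (𝓝 (geomSeries c z)) := by
  rw [← geomSeries_eq h.nonneg hs hz]
  have hseg : Tendsto (fun x : ℝ => (x : ℂ) + (1 - (x : ℂ)) * z) (𝓝[<] 1)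
      (𝓝[Metric.closedBall 0 1] 1) := by
    refine tendsto_nhdsWithin_iff.2 ⟨?_, ?_⟩
    · have : Continuous fun x : ℝ => (x : ℂ) + (1 - (x : ℂ)) * z := by fun_prop
      simpa using (this.tendsto 1).mono_left nhdsWithin_le_nhds
    · filter_upwards [Ioo_mem_nhdsLT (zero_lt_one' ℝ)] with x hx
      simpa using (norm_segment_lt_one hz hx.1.le hx.2).le
  have hc : Tendsto (primitiveSeries c) (𝓝[Metric.closedBall 0 1] 1) (𝓝 (primitiveSeries c 1)) :=
    continuousOn_primitiveSeries h.nonneg hs 1 (by simp)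
  refine Tendsto.congr' ?_ (((hc.comp hseg).sub_const (primitiveSeries c z)).div_const (1 - z))
  filter_upwards [Ioo_mem_nhdsLT (zero_lt_one' ℝ)] with x hx
  rw [h.liberaTrunc_eq hz hx.1.le hx.2]
  rfl

theorem liberaExists_iff_summable (h : IsPrimitiveCoeff g c) : LiberaExists g ↔ Summable c :=
  ⟨h.summable_of_liberaExists, fun hs z hz =>
    ⟨geomSeries c z, h.tendsto_liberaTrunc hs (mem_unitDisk.1 hz)⟩⟩

theorem libera_eq_geomSeries (h : IsPrimitiveCoeff g c) (hs : Summable c) :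
    EqOn (libera g) (geomSeries c) unitDisk := fun _ hz =>
  (h.tendsto_liberaTrunc hs (mem_unitDisk.1 hz)).limUnder_eq

end IsPrimitiveCoeff

/-! ### The series of geometric polynomials -/

section geomSeries

variable {c : ℕ → ℝ}

theorem norm_geomSeries_term_le (h0 : ∀ n, 0 ≤ c n) {r : ℝ} (hr : r < 1) (n : ℕ) {w : ℂ}
    (hw : ‖w‖ ≤ r) : ‖(c n : ℂ) * geomPoly n w‖ ≤ c n * (1 - r)⁻¹ := by
  rw [norm_mul, Complex.norm_real, Real.norm_of_nonneg (h0 n)]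
  exact mul_le_mul_of_nonneg_left (norm_geomPoly_le_inv n hw hr) (h0 n)

theorem summable_geomSeries (h0 : ∀ n, 0 ≤ c n) (hs : Summable c) {z : ℂ} (hz : ‖z‖ < 1) :
    Summable fun n => (c n : ℂ) * geomPoly n z :=
  Summable.of_norm_bounded (hs.mul_right _) fun n => norm_geomSeries_term_le h0 hz n le_rfl

theorem differentiableOn_geomSeries (h0 : ∀ n, 0 ≤ c n) (hs : Summable c) :
    DifferentiableOn ℂ (geomSeries c) unitDisk := by
  intro z hz
  obtain ⟨r, hzr, hr⟩ := exists_between (mem_unitDisk.1 hz)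
  refine DifferentiableAt.differentiableWithinAt ?_
  refine (Complex.differentiableOn_tsum_of_summable_norm (hs.mul_right (1 - r)⁻¹)
    (fun n => ((differentiable_geomPoly n).const_mul _).differentiableOn)
    (Metric.isOpen_ball (x := (0 : ℂ)) (ε := r)) fun n w hw => ?_).differentiableAt
      (Metric.isOpen_ball.mem_nhds (by simpa using hzr))
  exact norm_geomSeries_term_le h0 hr n (by simpa using (Metric.mem_ball.1 hw).le)

theorem hasSum_deriv_geomSeries (h0 : ∀ n, 0 ≤ c n) (hs : Summable c) {z : ℂ} (hz : ‖z‖ < 1) :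
    HasSum (fun n => (c n : ℂ) * deriv (geomPoly n) z) (deriv (geomSeries c) z) := by
  obtain ⟨r, hzr, hr⟩ := exists_between hz
  have := Complex.hasSum_deriv_of_summable_norm (z := z) (hs.mul_right (1 - r)⁻¹)
    (fun n => ((differentiable_geomPoly n).const_mul (c n : ℂ)).differentiableOn)
    (Metric.isOpen_ball (x := (0 : ℂ)) (ε := r))
    (fun n w hw => norm_geomSeries_term_le h0 hr n (by simpa using (Metric.mem_ball.1 hw).le))
    (by simpa using hzr)
  refine (congrArg (fun f => HasSum f _) (funext fun n => ?_)).mpr this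
  exact (deriv_const_mul _ (differentiable_geomPoly n z)).symm

end geomSeries

/-! ### Polar coordinates and a Hardy-type inequality -/

theorem lintegral_Ioo_ofReal_deriv {F F' : ℝ → ℝ} {a b : ℝ} (hab : a ≤ b)
    (hc : ContinuousOn F (Icc a b)) (hd : ∀ x ∈ Ioo a b, HasDerivAt F (F' x) x)
    (h0 : ∀ x ∈ Ioo a b, 0 ≤ F' x) :
    ∫⁻ x in Ioo a b, ENNReal.ofReal (F' x) = ENNReal.ofReal (F b - F a) := by
  -- Nonnegativity gives integrability of F' even if F is only continuous at the endpoints, as for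
  -- the square root in `lintegral_inv_sqrt`.
  have hi := intervalIntegral.integrableOn_deriv_of_nonneg hc hd h0
  have h1 := intervalIntegral.integral_eq_sub_of_hasDerivAt_of_le hab hc hd
    ((intervalIntegrable_iff_integrableOn_Ioc_of_le hab).2 hi)
  rw [intervalIntegral.integral_of_le hab, integral_Ioc_eq_integral_Ioo] at h1
  rw [← h1]
  refine (ofReal_integral_eq_lintegral_ofReal (hi.mono_set Ioo_subset_Ioc_self) ?_).symm
  exact (ae_restrict_iff' measurableSet_Ioo).2 (ae_of_all _ h0)

theorem lintegral_diskArea {h : ℂ → ℝ≥0∞} (hm : Measurable h) :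
    ∫⁻ z, h z ∂diskArea = (ENNReal.ofReal Real.pi)⁻¹ *
      ∫⁻ r in Ioo (0 : ℝ) 1, ENNReal.ofReal r *
        ∫⁻ θ in Ioo (-Real.pi) Real.pi, h (circleMap 0 r θ) := by
  have hD : MeasurableSet unitDisk := isOpen_unitDisk.measurableSet
  rw [diskArea, lintegral_smul_measure, smul_eq_mul, ← lintegral_indicator hD,
    ← Complex.lintegral_comp_polarCoord_symm]
  congr 1
  have h1 : ∀ p : ℝ × ℝ, Complex.polarCoord.symm p = circleMap 0 p.1 p.2 := fun p => by
    rw [Complex.polarCoord_symm_apply, circleMap_zero, Complex.exp_mul_I, Complex.ofReal_cos,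
      Complex.ofReal_sin]
  have hcm : Measurable fun p : ℝ × ℝ => circleMap 0 p.1 p.2 := by
    unfold circleMap
    fun_prop
  have hmeas : Measurable fun p : ℝ × ℝ =>
      ENNReal.ofReal p.1 • unitDisk.indicator h (circleMap 0 p.1 p.2) := by
    refine (ENNReal.measurable_ofReal.comp measurable_fst).mul ?_
    exact (hm.indicator hD).comp hcm
  simp_rw [h1]
  rw [polarCoord_target, Measure.volume_eq_prod, ← Measure.prod_restrict,
    lintegral_prod _ hmeas.aemeasurable]
  -- Each circle about 0 lies wholly inside or wholly outside the disk, so the indicator depends on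
  -- r alone.
  have h2 : ∀ r ∈ Ioi (0 : ℝ), ∫⁻ θ in Ioo (-Real.pi) Real.pi,
      ENNReal.ofReal r • unitDisk.indicator h (circleMap 0 r θ) =
      (Iio (1 : ℝ)).indicator (fun r => ENNReal.ofReal r *
        ∫⁻ θ in Ioo (-Real.pi) Real.pi, h (circleMap 0 r θ)) r := by
    intro r hr
    have hmem : ∀ θ, circleMap 0 r θ ∈ unitDisk ↔ r < 1 := fun θ => by
      rw [mem_unitDisk, norm_circleMap_zero, abs_of_pos hr]
    by_cases hr1 : r < 1
    · rw [indicator_of_mem (by exact hr1)]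
      simp_rw [smul_eq_mul, indicator_of_mem ((hmem _).2 hr1)]
      rw [lintegral_const_mul]
      exact hm.comp (continuous_circleMap 0 r).measurable
    · rw [indicator_of_notMem (by exact hr1)]
      simp_rw [indicator_of_notMem (fun h' => hr1 ((hmem _).1 h'))]
      simp
  rw [setLIntegral_congr_fun measurableSet_Ioi h2, lintegral_indicator measurableSet_Iio,
    Measure.restrict_restrict measurableSet_Iio]
  congr 2
  ext x
  simp [and_comm]

/-- A form of Hardy's inequality: the radial increments of a holomorphic function are bounded by
the integral means of its derivative. -/
theorem two_mul_norm_sub_le {f : ℂ → ℂ} (hf : DifferentiableOn ℂ f unitDisk) {r : ℝ}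
    (h0 : 0 < r) (h1 : r < 1) :
    2 * ‖f r - f 0‖ ≤ r * ∫ θ in (-Real.pi)..Real.pi, ‖deriv f (circleMap 0 r θ)‖ := by
  have hmem : ∀ θ, circleMap 0 r θ ∈ unitDisk := fun θ => by
    rw [mem_unitDisk, norm_circleMap_zero, abs_of_pos h0]
    exact h1
  have hdc : Continuous fun θ => deriv f (circleMap 0 r θ) :=
    (hf.deriv isOpen_unitDisk).continuousOn.comp_continuous (continuous_circleMap 0 r) hmem
  have hu : ∀ θ : ℝ, HasDerivAt (fun θ => f (circleMap 0 r θ))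
      (deriv f (circleMap 0 r θ) * (circleMap 0 r θ * Complex.I)) θ := fun θ =>
    ((hf.differentiableAt (isOpen_unitDisk.mem_nhds (hmem θ))).hasDerivAt).comp θ
      (hasDerivAt_circleMap 0 r θ)
  have hv : ∀ θ : ℝ, HasDerivAt (fun θ : ℝ => (Real.pi : ℂ) - (θ : ℂ)) (-1) θ := fun θ =>
    (hasDerivAt_id θ).ofReal_comp.const_sub _
  have hu' : Continuous fun θ => deriv f (circleMap 0 r θ) * (circleMap 0 r θ * Complex.I) :=
    hdc.mul ((continuous_circleMap 0 r).mul continuous_const)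
  -- Integration by parts against π - θ on [0, 2π]: the boundary terms give -2π f(r), the mean value
  -- property turns the remaining integral into 2π f(0), and |π - θ| ≤ π.
  have hparts := intervalIntegral.integral_mul_deriv_eq_deriv_mul (a := 0) (b := 2 * Real.pi)
    (fun θ _ => hu θ) (fun θ _ => hv θ) (hu'.intervalIntegrable _ _)
    (continuous_const.intervalIntegrable _ _)
  have hmv : ∫ θ in (0 : ℝ)..2 * Real.pi, f (circleMap 0 r θ) = 2 * Real.pi * f 0 := by
    have hd : DiffContOnCl ℂ f (Metric.ball 0 |r|) := by
      refine DifferentiableOn.diffContOnCl (hf.mono ?_)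
      refine Metric.closure_ball_subset_closedBall.trans (Metric.closedBall_subset_ball ?_)
      rwa [abs_of_pos h0]
    have h2 := hd.circleAverage
    rw [Real.circleAverage_def, Complex.real_smul] at h2
    rw [← h2]
    have : (Real.pi : ℂ) ≠ 0 := by exact_mod_cast Real.pi_ne_zero
    push_cast
    field_simp
  have hkey : 2 * Real.pi * (f r - f 0) = -∫ θ in (0 : ℝ)..2 * Real.pi,
      deriv f (circleMap 0 r θ) * (circleMap 0 r θ * Complex.I) * ((Real.pi : ℂ) - (θ : ℂ)) := by
    rw [intervalIntegral.integral_mul_const, hmv] at hparts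
    have e1 : circleMap 0 r (2 * Real.pi) = r := by simp [circleMap]
    have e2 : circleMap 0 r 0 = r := by simp [circleMap]
    rw [e1, e2] at hparts
    push_cast at hparts
    linear_combination hparts
  have hbound : ‖∫ θ in (0 : ℝ)..2 * Real.pi,
      deriv f (circleMap 0 r θ) * (circleMap 0 r θ * Complex.I) * ((Real.pi : ℂ) - (θ : ℂ))‖ ≤
      ∫ θ in (0 : ℝ)..2 * Real.pi, r * Real.pi * ‖deriv f (circleMap 0 r θ)‖ := by
    refine intervalIntegral.norm_integral_le_of_norm_le Real.two_pi_pos.le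
      (ae_of_all _ fun θ hθ => ?_)
      ((continuous_const.mul hdc.norm).intervalIntegrable _ _)
    have e3 : ‖(Real.pi : ℂ) - (θ : ℂ)‖ ≤ Real.pi := by
      rw [← Complex.ofReal_sub, Complex.norm_real, Real.norm_eq_abs, abs_le]
      constructor <;> linarith [hθ.1, hθ.2]
    rw [norm_mul, norm_mul, norm_mul, norm_circleMap_zero, abs_of_pos h0, Complex.norm_I, mul_one]
    calc _ ≤ ‖deriv f (circleMap 0 r θ)‖ * r * Real.pi := by gcongr
      _ = _ := by ring
  rw [intervalIntegral.integral_const_mul] at hbound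
  have hper : Function.Periodic (fun θ => ‖deriv f (circleMap 0 r θ)‖) (2 * Real.pi) :=
    fun θ => by simp only [periodic_circleMap 0 r θ]
  have hshift := hper.intervalIntegral_add_eq (-Real.pi) 0
  rw [zero_add, show -Real.pi + 2 * Real.pi = Real.pi by ring] at hshift
  rw [hshift]
  have hnorm := congrArg norm hkey
  rw [norm_neg, norm_mul, norm_mul, Complex.norm_real, Real.norm_of_nonneg Real.pi_pos.le,
    Complex.norm_ofNat] at hnorm
  rw [← hnorm] at hbound
  have hpi := Real.pi_pos
  refine le_of_mul_le_mul_left ?_ hpi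
  linarith

theorem two_mul_enorm_sub_le {f : ℂ → ℂ} (hf : DifferentiableOn ℂ f unitDisk) {r : ℝ}
    (h0 : 0 < r) (h1 : r < 1) :
    2 * ‖f r - f 0‖ₑ ≤ ENNReal.ofReal r *
      ∫⁻ θ in Ioo (-Real.pi) Real.pi, ‖deriv f (circleMap 0 r θ)‖ₑ := by
  have hmem : ∀ θ, circleMap 0 r θ ∈ unitDisk := fun θ => by
    rw [mem_unitDisk, norm_circleMap_zero, abs_of_pos h0]
    exact h1
  have hdc : Continuous fun θ => ‖deriv f (circleMap 0 r θ)‖ :=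
    ((hf.deriv isOpen_unitDisk).continuousOn.comp_continuous
      (continuous_circleMap 0 r) hmem).norm
  have h2 := ENNReal.ofReal_le_ofReal (two_mul_norm_sub_le hf h0 h1)
  have hpi : -Real.pi ≤ Real.pi := by linarith [Real.pi_pos]
  have hint := (intervalIntegrable_iff_integrableOn_Ioc_of_le hpi).1
    (hdc.intervalIntegrable (μ := volume) (-Real.pi) Real.pi)
  rw [ENNReal.ofReal_mul zero_le_two, ENNReal.ofReal_mul h0.le, ofReal_norm,
    intervalIntegral.integral_of_le hpi, integral_Ioc_eq_integral_Ioo,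
    ofReal_integral_eq_lintegral_ofReal (hint.mono_set Ioo_subset_Ioc_self)
      (ae_of_all _ fun _ => norm_nonneg _)] at h2
  simpa only [ofReal_norm, ENNReal.ofReal_ofNat] using h2

/-! ### The logarithmic weight -/

/-- The function `log (2 / (1 - r))`. -/
noncomputable def logWeight (r : ℝ) : ℝ := Real.log (2 / (1 - r))

theorem logWeight_pos {r : ℝ} (h0 : 0 ≤ r) (h1 : r < 1) : 0 < logWeight r := by
  refine Real.log_pos ?_
  rw [lt_div_iff₀ (by linarith)]
  linarith

theorem hasDerivAt_logWeight {r : ℝ} (h1 : r < 1) : HasDerivAt logWeight (1 / (1 - r)) r := by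
  have h : (1 - r) ≠ 0 := by linarith
  have h2 : HasDerivAt (fun r : ℝ => 2 / (1 - r)) (2 / (1 - r) ^ 2) r := by
    have := (((hasDerivAt_id r).const_sub 1).inv h).const_mul 2
    refine this.congr_deriv ?_
    simp [div_eq_mul_inv]
  have h3 := h2.log (by positivity)
  refine h3.congr_deriv ?_
  field_simp

theorem hasDerivAt_logWeight_rpow {β r : ℝ} (h0 : 0 ≤ r) (h1 : r < 1) :
    HasDerivAt (fun r => logWeight r ^ β) (β * logWeight r ^ (β - 1) / (1 - r)) r := by
  have := (hasDerivAt_logWeight h1).rpow_const (p := β) (Or.inl (logWeight_pos h0 h1).ne')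
  convert this using 1
  ring

theorem logWeight_one_sub_inv {x : ℝ} : logWeight (1 - 1 / x) = Real.log (2 * x) := by
  simp [logWeight]

theorem lintegral_logWeight_rpow_div {α a b : ℝ} (hα : -1 < α) (ha : 0 ≤ a) (hab : a ≤ b)
    (hb : b < 1) {k : ℝ} (hk : 0 ≤ k) :
    ∫⁻ r in Ioo a b, ENNReal.ofReal (k * (logWeight r ^ α / (1 - r))) =
      ENNReal.ofReal (k / (α + 1) * (logWeight b ^ (α + 1) - logWeight a ^ (α + 1))) := by
  have hd : ∀ x ∈ Icc a b, HasDerivAt (fun r => k / (α + 1) * logWeight r ^ (α + 1))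
      (k * (logWeight x ^ α / (1 - x))) x := fun x hx => by
    have := (hasDerivAt_logWeight_rpow (β := α + 1) (ha.trans hx.1)
      (hx.2.trans_lt hb)).const_mul (k / (α + 1))
    refine this.congr_deriv ?_
    have : α + 1 ≠ 0 := by linarith
    rw [add_sub_cancel_right]
    field_simp
  rw [lintegral_Ioo_ofReal_deriv hab (fun x hx => (hd x hx).continuousAt.continuousWithinAt)
    (fun x hx => hd x (Ioo_subset_Icc_self hx))]
  · rw [mul_sub]
  · intro x hx
    have h1 := logWeight_pos (ha.trans hx.1.le) (hx.2.trans hb)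
    have h2 : 0 < 1 - x := by linarith [hx.2]
    positivity

/-- Since 2/δ = 2x · (xδ)⁻¹, the logarithm exceeds log(2x) only by log((xδ)⁻¹), which any small
power of (xδ)⁻¹ absorbs. The resulting singularity (xδ)^(-1/2) is integrable. -/
theorem exists_log_rpow_le (β : ℝ) (hβ : 0 < β) : ∃ K : ℝ, 0 < K ∧ ∀ x : ℝ, 1 ≤ x →
    ∀ δ : ℝ, 0 < δ → x * δ ≤ 1 →
      Real.log (2 / δ) ^ β ≤ K * Real.log (2 * x) ^ β / √(x * δ) := by
  set M : ℝ := 1 + 2 * β / Real.log 2 with hM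
  have hlog2 : 0 < Real.log 2 := Real.log_pos one_lt_two
  have hMpos : 0 < M := by positivity
  refine ⟨M ^ β, by positivity, fun x hx δ hδ hxδ => ?_⟩
  have hx0 : 0 < x := by linarith
  have hu : 0 < x * δ := by positivity
  have hv : 1 ≤ (x * δ)⁻¹ := (one_le_inv₀ hu).2 hxδ
  have hlx : Real.log 2 ≤ Real.log (2 * x) := Real.log_le_log two_pos (by linarith)
  -- The exponent is chosen so that v^β = (xδ)^(-1/2).
  set v : ℝ := ((x * δ)⁻¹) ^ (1 / (2 * β)) with hvdef
  have hv1 : 1 ≤ v := Real.one_le_rpow hv (by positivity)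
  have h1 : Real.log ((x * δ)⁻¹) ≤ 2 * β * v := by
    refine (Real.log_le_rpow_div (by positivity) (ε := 1 / (2 * β)) (by positivity)).trans ?_
    rw [← hvdef]
    refine le_of_eq ?_
    field_simp
  have h2 : Real.log (2 / δ) ≤ Real.log (2 * x) * M * v := by
    have e : 2 / δ = (2 * x) * (x * δ)⁻¹ := by field_simp
    rw [e, Real.log_mul (by positivity) (by positivity)]
    have h3 : 2 * β * v ≤ Real.log (2 * x) * (2 * β / Real.log 2) * v := by
      refine mul_le_mul_of_nonneg_right ?_ (by positivity)
      rw [mul_div_assoc', le_div_iff₀ hlog2]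
      nlinarith
    have h4 : Real.log (2 * x) ≤ Real.log (2 * x) * v :=
      le_mul_of_one_le_right (hlog2.le.trans hlx) hv1
    calc _ ≤ Real.log (2 * x) * v + Real.log (2 * x) * (2 * β / Real.log 2) * v := by linarith
      _ = _ := by rw [hM]; ring
  have h5 : 0 ≤ Real.log (2 / δ) := by
    refine Real.log_nonneg ?_
    rw [le_div_iff₀ hδ]
    nlinarith
  have hl0 : 0 < Real.log (2 * x) := by linarith
  calc Real.log (2 / δ) ^ β ≤ (Real.log (2 * x) * M * v) ^ β := Real.rpow_le_rpow h5 h2 hβ.le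
    _ = M ^ β * Real.log (2 * x) ^ β * v ^ β := by
        rw [Real.mul_rpow (by positivity) (by positivity), Real.mul_rpow hl0.le hMpos.le]
        ring
    _ = _ := by
        have : v ^ β = 1 / √(x * δ) := by
          rw [hvdef, ← Real.rpow_mul (by positivity), Real.sqrt_eq_rpow, one_div (_ ^ _),
            ← Real.inv_rpow hu.le]
          congr 1
          field_simp
        rw [this, mul_one_div]

/-! ### Integral means of the derivatives of the geometric polynomials -/

theorem lintegral_Ioo_abs_le (h : ℝ → ℝ≥0∞) (a : ℝ) :
    ∫⁻ θ in Ioo (-a) a, h |θ| ≤ 2 * ∫⁻ θ in Ioo 0 a, h θ := by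
  have hsub : Ioo (-a) a ⊆ (Ioo (-a) 0 ∪ Ioo 0 a) ∪ {0} := fun x hx => by
    rcases lt_trichotomy x 0 with h1 | h1 | h1
    · exact Or.inl (Or.inl ⟨hx.1, h1⟩)
    · exact Or.inr h1
    · exact Or.inl (Or.inr ⟨h1, hx.2⟩)
  have hz : ∫⁻ θ in ({0} : Set ℝ), h |θ| = 0 := by simp
  have hpos : ∫⁻ θ in Ioo 0 a, h |θ| = ∫⁻ θ in Ioo 0 a, h θ :=
    setLIntegral_congr_fun measurableSet_Ioo fun θ hθ => by
      simp only [abs_of_pos hθ.1]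
  have hneg : ∫⁻ θ in Ioo (-a) 0, h |θ| = ∫⁻ θ in Ioo 0 a, h |θ| := by
    have := (Measure.measurePreserving_neg (volume : Measure ℝ)).setLIntegral_comp_preimage_emb
      (MeasurableEquiv.neg ℝ).measurableEmbedding (fun θ => h |θ|) (Ioo 0 a)
    simpa using this
  calc _ ≤ ∫⁻ θ in (Ioo (-a) 0 ∪ Ioo 0 a) ∪ {0}, h |θ| := lintegral_mono_set hsub
    _ ≤ (∫⁻ θ in Ioo (-a) 0, h |θ|) + (∫⁻ θ in Ioo 0 a, h |θ|) + ∫⁻ θ in ({0} : Set ℝ), h |θ| :=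
        (lintegral_union_le _ _ _).trans (add_le_add_left (lintegral_union_le _ _ _) _)
    _ = _ := by rw [hz, hneg, hpos, two_mul, add_zero]

/-- With u = |θ|/π, the bound cos θ ≤ 1 - 2u² gives |1 - re^{iθ}|² ≥ (1-r)² + 4ru², to be compared
with (1-r+u)²/4 ≤ ((1-r)² + u²)/2. -/
theorem le_norm_one_sub_circleMap {r θ : ℝ} (h0 : 0 ≤ r) (hθ : |θ| ≤ Real.pi) :
    (1 - r + |θ| / Real.pi) / 2 ≤ ‖1 - circleMap 0 r θ‖ := by
  have hpi := Real.pi_pos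
  have hu1 : |θ| / Real.pi ≤ 1 := (div_le_one hpi).2 hθ
  have hu0 : 0 ≤ |θ| / Real.pi := by positivity
  have hcos := Real.cos_le_one_sub_mul_cos_sq hθ
  have hsq : 2 / Real.pi ^ 2 * θ ^ 2 = 2 * (|θ| / Real.pi) ^ 2 := by
    rw [div_pow, sq_abs]
    ring
  rw [hsq] at hcos
  have hn : ‖1 - circleMap 0 r θ‖ ^ 2 = 1 - 2 * r * Real.cos θ + r ^ 2 := by
    rw [circleMap_zero, Complex.exp_mul_I, ← Complex.ofReal_cos, ← Complex.ofReal_sin,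
      Complex.sq_norm, Complex.normSq_apply]
    simp [-Complex.ofReal_cos, -Complex.ofReal_sin]
    linear_combination r ^ 2 * Real.sin_sq_add_cos_sq θ
  refine le_of_sq_le_sq ?_ (norm_nonneg _)
  rw [hn]
  generalize |θ| / Real.pi = u at *
  have h2 : r * Real.cos θ ≤ r * (1 - 2 * u ^ 2) := mul_le_mul_of_nonneg_left hcos h0
  have hu2 : u ^ 2 ≤ 1 := pow_le_one₀ hu0 hu1
  -- Affine in u² ∈ [0, 1], with endpoint values (1-r)² and r² + 6r.
  have h3 : 0 ≤ (1 - r) ^ 2 + (8 * r - 1) * u ^ 2 := by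
    nlinarith [mul_nonneg h0 (sq_nonneg u), mul_nonneg h0 (sub_nonneg.2 hu2), sq_nonneg (1 - r)]
  nlinarith [sq_nonneg (1 - r - u)]

theorem lintegral_inv_norm_one_sub_circleMap_le {r : ℝ} (h0 : 0 ≤ r) (h1 : r < 1) :
    ∫⁻ θ in Ioo (-Real.pi) Real.pi, ENNReal.ofReal (1 / ‖1 - circleMap 0 r θ‖) ≤
      ENNReal.ofReal (4 * Real.pi * logWeight r) := by
  have hpi := Real.pi_pos
  have hδ : 0 < 1 - r := by linarith
  have hpos : ∀ θ : ℝ, 0 ≤ θ → 0 < 1 - r + θ / Real.pi := fun θ hθ => by positivity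
  have hd : ∀ θ ∈ Icc 0 Real.pi, HasDerivAt
      (fun θ => 2 * Real.pi * Real.log (1 - r + θ / Real.pi))
      (2 / (1 - r + θ / Real.pi)) θ := fun θ hθ => by
    have := ((((hasDerivAt_id θ).div_const Real.pi).const_add (1 - r)).log
      (hpos θ hθ.1).ne').const_mul (2 * Real.pi)
    refine this.congr_deriv ?_
    simp only [id]
    field_simp
  calc _ ≤ ∫⁻ θ in Ioo (-Real.pi) Real.pi, ENNReal.ofReal (2 / (1 - r + |θ| / Real.pi)) := by
        refine setLIntegral_mono' measurableSet_Ioo fun θ hθ => ENNReal.ofReal_le_ofReal ?_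
        have h2 := le_norm_one_sub_circleMap h0 (abs_lt.2 hθ).le
        have h3 := hpos |θ| (abs_nonneg _)
        rw [show 2 / (1 - r + |θ| / Real.pi) = 1 / ((1 - r + |θ| / Real.pi) / 2) by field_simp]
        exact one_div_le_one_div_of_le (by positivity) h2
    _ ≤ 2 * ∫⁻ θ in Ioo 0 Real.pi, ENNReal.ofReal (2 / (1 - r + θ / Real.pi)) :=
        lintegral_Ioo_abs_le (fun t => ENNReal.ofReal (2 / (1 - r + t / Real.pi))) _
    _ ≤ _ := by
        rw [lintegral_Ioo_ofReal_deriv hpi.le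
          (fun θ hθ => (hd θ hθ).continuousAt.continuousWithinAt)
          (fun θ hθ => hd θ (Ioo_subset_Icc_self hθ))
          (fun θ hθ => div_nonneg zero_le_two (hpos θ hθ.1.le).le),
          show (2 : ℝ≥0∞) = ENNReal.ofReal 2 by simp, ← ENNReal.ofReal_mul zero_le_two]
        refine ENNReal.ofReal_le_ofReal ?_
        rw [logWeight, Real.log_div two_ne_zero hδ.ne', div_self hpi.ne', zero_div, add_zero]
        have : Real.log (1 - r + 1) ≤ Real.log 2 := Real.log_le_log (by linarith) (by linarith)
        nlinarith

theorem lintegral_inv_norm_one_sub_circleMap_sq_le {r : ℝ} (h0 : 0 ≤ r) (h1 : r < 1) :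
    ∫⁻ θ in Ioo (-Real.pi) Real.pi, ENNReal.ofReal (1 / ‖1 - circleMap 0 r θ‖ ^ 2) ≤
      ENNReal.ofReal (8 * Real.pi / (1 - r)) := by
  have hpi := Real.pi_pos
  have hδ : 0 < 1 - r := by linarith
  have hpos : ∀ θ : ℝ, 0 ≤ θ → 0 < 1 - r + θ / Real.pi := fun θ hθ => by positivity
  have hd : ∀ θ ∈ Icc 0 Real.pi, HasDerivAt
      (fun θ => -(4 * Real.pi) * (1 - r + θ / Real.pi)⁻¹)
      (4 / (1 - r + θ / Real.pi) ^ 2) θ := fun θ hθ => by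
    have := ((((hasDerivAt_id θ).div_const Real.pi).const_add (1 - r)).inv
      (hpos θ hθ.1).ne').const_mul (-(4 * Real.pi))
    refine this.congr_deriv ?_
    simp only [id]
    field_simp
  calc _ ≤ ∫⁻ θ in Ioo (-Real.pi) Real.pi, ENNReal.ofReal (4 / (1 - r + |θ| / Real.pi) ^ 2) := by
        refine setLIntegral_mono' measurableSet_Ioo fun θ hθ => ENNReal.ofReal_le_ofReal ?_
        have h2 := le_norm_one_sub_circleMap h0 (abs_lt.2 hθ).le
        have h3 := hpos |θ| (abs_nonneg _)
        rw [show 4 / (1 - r + |θ| / Real.pi) ^ 2 = 1 / ((1 - r + |θ| / Real.pi) / 2) ^ 2 by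
          field_simp; norm_num]
        exact one_div_le_one_div_of_le (by positivity) (by gcongr)
    _ ≤ 2 * ∫⁻ θ in Ioo 0 Real.pi, ENNReal.ofReal (4 / (1 - r + θ / Real.pi) ^ 2) :=
        lintegral_Ioo_abs_le (fun t => ENNReal.ofReal (4 / (1 - r + t / Real.pi) ^ 2)) _
    _ ≤ _ := by
        rw [lintegral_Ioo_ofReal_deriv hpi.le
          (fun θ hθ => (hd θ hθ).continuousAt.continuousWithinAt)
          (fun θ hθ => hd θ (Ioo_subset_Icc_self hθ))
          (fun θ hθ => div_nonneg (by norm_num) (sq_nonneg _)),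
          show (2 : ℝ≥0∞) = ENNReal.ofReal 2 by simp, ← ENNReal.ofReal_mul zero_le_two]
        refine ENNReal.ofReal_le_ofReal ?_
        rw [div_self hpi.ne', zero_div, add_zero]
        have : 0 < (1 - r + 1)⁻¹ := by positivity
        rw [div_eq_mul_inv]
        nlinarith

theorem norm_circleMap_lt_one {r : ℝ} (h0 : 0 ≤ r) (h1 : r < 1) (θ : ℝ) :
    ‖circleMap 0 r θ‖ < 1 := by
  rwa [norm_circleMap_zero, abs_of_nonneg h0]

theorem lintegral_deriv_geomPoly_le (n : ℕ) {r : ℝ} (h0 : 0 ≤ r) (h1 : r < 1) :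
    ∫⁻ θ in Ioo (-Real.pi) Real.pi, ‖deriv (geomPoly n) (circleMap 0 r θ)‖ₑ ≤
      ENNReal.ofReal (8 * Real.pi * (n + 1) * logWeight r) := by
  calc _ ≤ ∫⁻ θ in Ioo (-Real.pi) Real.pi, ENNReal.ofReal (2 * (n + 1)) *
        ENNReal.ofReal (1 / ‖1 - circleMap 0 r θ‖) := by
        refine lintegral_mono fun θ => ?_
        rw [← ofReal_norm, ← ENNReal.ofReal_mul (by positivity), mul_one_div]
        exact ENNReal.ofReal_le_ofReal
          (norm_deriv_geomPoly_le_div n (norm_circleMap_lt_one h0 h1 θ))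
    _ = ENNReal.ofReal (2 * (n + 1)) * ∫⁻ θ in Ioo (-Real.pi) Real.pi,
        ENNReal.ofReal (1 / ‖1 - circleMap 0 r θ‖) :=
        lintegral_const_mul' _ _ ENNReal.ofReal_ne_top
    _ ≤ ENNReal.ofReal (2 * (n + 1)) * ENNReal.ofReal (4 * Real.pi * logWeight r) := by
        gcongr
        exact lintegral_inv_norm_one_sub_circleMap_le h0 h1
    _ = _ := by
        rw [← ENNReal.ofReal_mul (by positivity)]
        congr 1
        ring

theorem lintegral_deriv_geomPoly_le_add (n : ℕ) {r : ℝ} (h0 : 0 ≤ r) (h1 : r < 1) :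
    ∫⁻ θ in Ioo (-Real.pi) Real.pi, ‖deriv (geomPoly n) (circleMap 0 r θ)‖ₑ ≤
      ENNReal.ofReal (16 * Real.pi / (1 - r)) +
        ENNReal.ofReal (4 * Real.pi * ((n + 1) * r ^ n) * logWeight r) := by
  calc _ ≤ ∫⁻ θ in Ioo (-Real.pi) Real.pi,
        (ENNReal.ofReal 2 * ENNReal.ofReal (1 / ‖1 - circleMap 0 r θ‖ ^ 2) +
          ENNReal.ofReal ((n + 1) * r ^ n) * ENNReal.ofReal (1 / ‖1 - circleMap 0 r θ‖)) := by
        refine lintegral_mono fun θ => ?_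
        rw [← ofReal_norm, ← ENNReal.ofReal_mul (by positivity),
          ← ENNReal.ofReal_mul (by positivity), mul_one_div, mul_one_div,
          ← ENNReal.ofReal_add (by positivity) (by positivity)]
        refine ENNReal.ofReal_le_ofReal ?_
        have := norm_deriv_geomPoly_le_add n (norm_circleMap_lt_one h0 h1 θ)
        rwa [show ‖circleMap 0 r θ‖ = r by rw [norm_circleMap_zero, abs_of_nonneg h0]] at this
    _ = ENNReal.ofReal 2 * (∫⁻ θ in Ioo (-Real.pi) Real.pi,
          ENNReal.ofReal (1 / ‖1 - circleMap 0 r θ‖ ^ 2)) +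
        ENNReal.ofReal ((n + 1) * r ^ n) * ∫⁻ θ in Ioo (-Real.pi) Real.pi,
          ENNReal.ofReal (1 / ‖1 - circleMap 0 r θ‖) := by
        have hc := (continuous_circleMap 0 r).measurable
        rw [lintegral_add_left (by fun_prop), lintegral_const_mul' _ _ ENNReal.ofReal_ne_top,
          lintegral_const_mul' _ _ ENNReal.ofReal_ne_top]
    _ ≤ ENNReal.ofReal 2 * ENNReal.ofReal (8 * Real.pi / (1 - r)) +
        ENNReal.ofReal ((n + 1) * r ^ n) * ENNReal.ofReal (4 * Real.pi * logWeight r) := by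
        gcongr
        · exact lintegral_inv_norm_one_sub_circleMap_sq_le h0 h1
        · exact lintegral_inv_norm_one_sub_circleMap_le h0 h1
    _ = _ := by
        rw [← ENNReal.ofReal_mul (by positivity), ← ENNReal.ofReal_mul (by positivity)]
        congr 2 <;> ring

/-! ### Weighted area integrals of the derivatives of geometric polynomials -/

theorem log_two_mul_rpow_le {β : ℝ} (hβ : 0 < β) (n : ℕ) :
    Real.log (2 * (n + 1)) ^ β ≤ 2 ^ β * Real.log (n + 2) ^ β := by
  have hn : (0 : ℝ) ≤ n := n.cast_nonneg
  have h1 : 0 ≤ Real.log (2 * ((n : ℝ) + 1)) := Real.log_nonneg (by linarith)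
  have h2 : 0 ≤ Real.log ((n : ℝ) + 2) := Real.log_nonneg (by linarith)
  rw [← Real.mul_rpow zero_le_two h2]
  refine Real.rpow_le_rpow h1 ?_ hβ.le
  have : 2 * Real.log ((n : ℝ) + 2) = Real.log (((n : ℝ) + 2) ^ 2) := by
    rw [Real.log_pow]
    norm_num
  rw [this]
  exact Real.log_le_log (by linarith) (by nlinarith)

theorem logWeight_rpow_mono {β : ℝ} (hβ : 0 < β) {r s : ℝ} (h0 : 0 ≤ r) (hrs : r ≤ s)
    (hs : s < 1) : logWeight r ^ β ≤ logWeight s ^ β := by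
  refine Real.rpow_le_rpow (logWeight_pos h0 (hrs.trans_lt hs)).le ?_ hβ.le
  have h1 : 0 < 1 - s := by linarith
  have h2 : 0 < 1 - r := by linarith
  refine Real.log_le_log (by positivity) ?_
  gcongr

theorem logWeight_mul_rpow {α r : ℝ} (h0 : 0 ≤ r) (h1 : r < 1) :
    logWeight r * logWeight r ^ α = logWeight r ^ (α + 1) := by
  rw [Real.rpow_add_one (logWeight_pos h0 h1).ne', mul_comm]

/-- The substitution y = x(1-r) removes x, so the outer annulus costs only a constant multiple of k.
-/
theorem lintegral_inv_sqrt {x k : ℝ} (hx : 1 ≤ x) (hk : 0 ≤ k) :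
    ∫⁻ r in Ioo (1 - 1 / x) 1, ENNReal.ofReal (k * x / √(x * (1 - r))) =
      ENNReal.ofReal (2 * k) := by
  have hx0 : 0 < x := by linarith
  have hs : 1 - 1 / x ≤ 1 := by
    have : 0 < 1 / x := by positivity
    linarith
  rw [lintegral_Ioo_ofReal_deriv (F := fun r => -(2 * k) * √(x * (1 - r))) hs (by fun_prop)]
  · congr 1
    rw [sub_sub_cancel, mul_one_div, div_self hx0.ne']
    simp
  · intro r hr
    have h1 : 0 < x * (1 - r) := mul_pos hx0 (by linarith [hr.2])
    have h2 : 0 < √(x * (1 - r)) := Real.sqrt_pos.2 h1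
    have := ((((hasDerivAt_id r).const_sub 1).const_mul x).sqrt h1.ne').const_mul (-(2 * k))
    refine this.congr_deriv ?_
    simp only [id]
    field_simp
  · intro r _
    positivity

theorem lintegral_mul_pow (n : ℕ) {k : ℝ} (hk : 0 ≤ k) :
    ∫⁻ r in Ioo (0 : ℝ) 1, ENNReal.ofReal (k * ((n + 1) * r ^ n)) = ENNReal.ofReal k := by
  rw [lintegral_Ioo_ofReal_deriv (F := fun r => k * r ^ (n + 1)) zero_le_one (by fun_prop)]
  · simp
  · intro r _
    refine ((hasDerivAt_pow (n + 1) r).const_mul k).congr_deriv ?_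
    push_cast
    simp
  · intro r hr
    have := hr.1
    positivity

theorem exists_lintegral_deriv_geomPoly_le {α : ℝ} (hα : -1 < α) : ∃ K : ℝ, 0 < K ∧ ∀ n : ℕ,
    ∫⁻ z, ‖deriv (geomPoly n) z‖ₑ * ENNReal.ofReal (logWeight ‖z‖ ^ α) ∂diskArea ≤
      ENNReal.ofReal (K * Real.log (n + 2) ^ (α + 1)) := by
  have hβ : 0 < α + 1 := by linarith
  have hpi := Real.pi_pos
  obtain ⟨K₁, hK₁, hlog⟩ := exists_log_rpow_le (α + 1) hβ
  -- The first two summands come from the two terms of `hleft`, the third from `hright`; the factor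
  -- 2^(α+1) replaces log(2(n+1)) by log(n+2).
  refine ⟨(16 * Real.pi / (α + 1) + 4 * Real.pi + 16 * Real.pi * K₁) * 2 ^ (α + 1),
    by positivity, fun n => ?_⟩
  set T : ℝ := Real.log (2 * (n + 1)) ^ (α + 1) with hT
  have hn : (1 : ℝ) ≤ n + 1 := by simp
  have hT0 : 0 ≤ T := Real.rpow_nonneg (Real.log_nonneg (by linarith)) _
  -- At this cutoff `logWeight s` is exactly log(2(n+1)).
  set s : ℝ := 1 - 1 / (n + 1) with hs
  have hs0 : 0 ≤ s := sub_nonneg.2 ((div_le_one (by linarith)).2 hn)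
  have hs1 : s < 1 := sub_lt_self _ (by positivity)
  have hTs : logWeight s ^ (α + 1) = T := by rw [hs, logWeight_one_sub_inv]
  set J : ℝ → ℝ≥0∞ := fun r =>
    ∫⁻ θ in Ioo (-Real.pi) Real.pi, ‖deriv (geomPoly n) (circleMap 0 r θ)‖ₑ with hJ
  have hmeas : Measurable fun z : ℂ =>
      ‖deriv (geomPoly n) z‖ₑ * ENNReal.ofReal (logWeight ‖z‖ ^ α) := by
    have := measurable_deriv (geomPoly n)
    unfold logWeight
    fun_prop
  have hinner : ∀ r ∈ Ioo (0 : ℝ) 1, ENNReal.ofReal r * ∫⁻ θ in Ioo (-Real.pi) Real.pi,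
      ‖deriv (geomPoly n) (circleMap 0 r θ)‖ₑ *
        ENNReal.ofReal (logWeight ‖circleMap 0 r θ‖ ^ α) ≤
      J r * ENNReal.ofReal (logWeight r ^ α) := fun r hr => by
    simp_rw [norm_circleMap_zero, abs_of_pos hr.1]
    rw [lintegral_mul_const' _ _ ENNReal.ofReal_ne_top]
    exact mul_le_of_le_one_left' (ENNReal.ofReal_le_one.2 hr.2.le)
  have hleft : ∀ r ∈ Ioo 0 s, J r * ENNReal.ofReal (logWeight r ^ α) ≤
      ENNReal.ofReal (16 * Real.pi * (logWeight r ^ α / (1 - r))) +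
        ENNReal.ofReal (4 * Real.pi * T * ((n + 1) * r ^ n)) := fun r hr => by
    have hr0 := hr.1
    have hr1 : r < 1 := hr.2.trans hs1
    have hw := logWeight_pos hr0.le hr1
    refine (mul_le_mul_left (lintegral_deriv_geomPoly_le_add n hr0.le hr1) _).trans ?_
    rw [add_mul, ← ENNReal.ofReal_mul (div_nonneg (by positivity) (by linarith)),
      ← ENNReal.ofReal_mul (by positivity)]
    refine add_le_add (le_of_eq ?_) (ENNReal.ofReal_le_ofReal ?_)
    · congr 1
      ring
    · rw [mul_assoc, logWeight_mul_rpow hr0.le hr1]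
      -- The weight to the power α need not be monotone upward when α < 0; the extra logarithm from
      -- the circular integral makes the exponent α + 1 > 0.
      have := logWeight_rpow_mono hβ hr0.le hr.2.le hs1
      rw [hTs] at this
      calc _ ≤ 4 * Real.pi * ((n + 1) * r ^ n) * T := by gcongr
        _ = _ := by ring
  have hright : ∀ r ∈ Ioo s 1, J r * ENNReal.ofReal (logWeight r ^ α) ≤
      ENNReal.ofReal (8 * Real.pi * K₁ * T * (n + 1) / √((n + 1) * (1 - r))) := fun r hr => by
    have hr0 : 0 ≤ r := hs0.trans hr.1.le
    have hr1 := hr.2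
    have hw := logWeight_pos hr0 hr1
    refine (mul_le_mul_left (lintegral_deriv_geomPoly_le n hr0 hr1) _).trans ?_
    rw [← ENNReal.ofReal_mul (by positivity), mul_assoc, logWeight_mul_rpow hr0 hr1]
    refine ENNReal.ofReal_le_ofReal ?_
    have hδ : ((n : ℝ) + 1) * (1 - r) ≤ 1 := by
      have h1 : 1 - r ≤ 1 / (n + 1) := by linarith [hr.1]
      rwa [le_div_iff₀ (by positivity), mul_comm] at h1
    have h2 := hlog (n + 1) hn (1 - r) (by linarith) hδ
    rw [← hT] at h2
    calc _ ≤ 8 * Real.pi * (n + 1) * (K₁ * T / √((n + 1) * (1 - r))) := by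
          gcongr
          exact h2
      _ = _ := by ring
  have hsub : Ioo (0 : ℝ) 1 ⊆ (Ioo 0 s ∪ Ioo s 1) ∪ {s} := fun x hx => by
    rcases lt_trichotomy x s with h1 | h1 | h1
    · exact Or.inl (Or.inl ⟨hx.1, h1⟩)
    · exact Or.inr h1
    · exact Or.inl (Or.inr ⟨h1, hx.2⟩)
  have hI1 : ∫⁻ r in Ioo 0 s, J r * ENNReal.ofReal (logWeight r ^ α) ≤
      ENNReal.ofReal (16 * Real.pi / (α + 1) * T) + ENNReal.ofReal (4 * Real.pi * T) := by
    refine (setLIntegral_mono' measurableSet_Ioo hleft).trans ?_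
    rw [lintegral_add_right _ (by fun_prop),
      lintegral_logWeight_rpow_div hα le_rfl hs0 hs1 (by positivity)]
    refine add_le_add (ENNReal.ofReal_le_ofReal ?_) ?_
    · rw [hTs]
      have : 0 ≤ logWeight 0 ^ (α + 1) :=
        Real.rpow_nonneg (logWeight_pos le_rfl zero_lt_one).le _
      gcongr
      linarith
    · rw [← lintegral_mul_pow n (show 0 ≤ 4 * Real.pi * T by positivity)]
      exact lintegral_mono_set (Ioo_subset_Ioo_right hs1.le)
  have hI2 : ∫⁻ r in Ioo s 1, J r * ENNReal.ofReal (logWeight r ^ α) ≤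
      ENNReal.ofReal (2 * (8 * Real.pi * K₁ * T)) := by
    refine (setLIntegral_mono' measurableSet_Ioo hright).trans (le_of_eq ?_)
    exact lintegral_inv_sqrt hn (by positivity)
  calc _ = (ENNReal.ofReal Real.pi)⁻¹ * ∫⁻ r in Ioo (0 : ℝ) 1, ENNReal.ofReal r *
        ∫⁻ θ in Ioo (-Real.pi) Real.pi, ‖deriv (geomPoly n) (circleMap 0 r θ)‖ₑ *
          ENNReal.ofReal (logWeight ‖circleMap 0 r θ‖ ^ α) := lintegral_diskArea hmeas
    _ ≤ 1 * ∫⁻ r in Ioo (0 : ℝ) 1, J r * ENNReal.ofReal (logWeight r ^ α) := by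
        refine mul_le_mul' ?_ (setLIntegral_mono' measurableSet_Ioo hinner)
        refine ENNReal.inv_le_one.2 (ENNReal.one_le_ofReal.2 ?_)
        linarith [Real.pi_gt_three]
    _ ≤ ∫⁻ r in (Ioo 0 s ∪ Ioo s 1) ∪ {s}, J r * ENNReal.ofReal (logWeight r ^ α) := by
        rw [one_mul]
        exact lintegral_mono_set hsub
    _ ≤ ((∫⁻ r in Ioo 0 s, J r * ENNReal.ofReal (logWeight r ^ α)) +
          ∫⁻ r in Ioo s 1, J r * ENNReal.ofReal (logWeight r ^ α)) +
          ∫⁻ r in ({s} : Set ℝ), J r * ENNReal.ofReal (logWeight r ^ α) :=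
        (lintegral_union_le _ _ _).trans (add_le_add_left (lintegral_union_le _ _ _) _)
    _ ≤ (ENNReal.ofReal (16 * Real.pi / (α + 1) * T) + ENNReal.ofReal (4 * Real.pi * T)) +
          ENNReal.ofReal (2 * (8 * Real.pi * K₁ * T)) := by
        rw [setLIntegral_measure_zero {s} _ (by simp), add_zero]
        exact add_le_add hI1 hI2
    _ ≤ _ := by
        rw [← ENNReal.ofReal_add (by positivity) (by positivity),
          ← ENNReal.ofReal_add (by positivity) (by positivity)]
        refine ENNReal.ofReal_le_ofReal ?_
        calc _ = (16 * Real.pi / (α + 1) + 4 * Real.pi + 16 * Real.pi * K₁) * T := by ring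
          _ ≤ (16 * Real.pi / (α + 1) + 4 * Real.pi + 16 * Real.pi * K₁) *
              (2 ^ (α + 1) * Real.log (n + 2) ^ (α + 1)) := by
              gcongr
              exact log_two_mul_rpow_le hβ n
          _ = _ := by ring

/-! ### The lower estimate -/

theorem geomPoly_ofReal (n : ℕ) (r : ℝ) :
    geomPoly n r = ((∑ k ∈ Finset.range (n + 1), r ^ k : ℝ) : ℂ) := by
  simp [geomPoly]

theorem one_le_sum_pow (n : ℕ) {r : ℝ} (h0 : 0 ≤ r) :
    1 ≤ ∑ k ∈ Finset.range (n + 1), r ^ k := by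
  rw [Finset.sum_range_succ', pow_zero]
  exact le_add_of_nonneg_left (Finset.sum_nonneg fun k _ => by positivity)

theorem enorm_geomPoly_sub_one (n : ℕ) {r : ℝ} (h0 : 0 ≤ r) :
    ‖geomPoly n r - 1‖ₑ = ENNReal.ofReal (∑ k ∈ Finset.range (n + 1), r ^ k - 1) := by
  rw [geomPoly_ofReal, ← Complex.ofReal_one, ← Complex.ofReal_sub, ← ofReal_norm,
    Complex.norm_real, Real.norm_of_nonneg (sub_nonneg.2 (one_le_sum_pow n h0))]

/-- Multiplied by 1 - r, the sum minus 1 becomes r(1 - r^n); here r ≥ 1/2, and r^n ≤ e⁻¹ ≤ 1/2. -/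
theorem inv_le_sum_pow_sub_one {n : ℕ} (hn : 0 < n) {r : ℝ} (h0 : 1 / 2 ≤ r)
    (h1 : r ≤ 1 - 1 / n) :
    1 / 4 * (1 / (1 - r)) ≤ ∑ k ∈ Finset.range (n + 1), r ^ k - 1 := by
  have hn' : (0 : ℝ) < n := by exact_mod_cast hn
  have hr1 : 0 < 1 - r := by
    have : (0 : ℝ) < 1 / n := by positivity
    linarith
  have hpow : r ^ n ≤ 1 / 2 := by
    calc r ^ n ≤ (Real.exp (-(1 / n))) ^ n := by
          gcongr
          exact h1.trans (Real.one_sub_le_exp_neg _)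
      _ = Real.exp (-1) := by
          rw [← Real.exp_nat_mul]
          congr 1
          field_simp
      _ ≤ 1 / 2 := by
          rw [Real.exp_neg, ← one_div]
          exact one_div_le_one_div_of_le two_pos (by linarith [Real.add_one_le_exp 1])
  have hsum := mul_neg_geom_sum r (n + 1)
  rw [mul_one_div, div_le_iff₀ hr1]
  have : (∑ k ∈ Finset.range (n + 1), r ^ k - 1) * (1 - r) = r * (1 - r ^ n) := by
    linear_combination hsum
  rw [this]
  nlinarith

theorem exists_log_rpow_le_lintegral {α : ℝ} (hα : -1 < α) : ∃ A : ℝ, 0 < A ∧ ∀ n : ℕ,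
    ENNReal.ofReal (Real.log (n + 2) ^ (α + 1)) ≤ ENNReal.ofReal A *
      (1 + ∫⁻ r in Ioo (0 : ℝ) 1, ENNReal.ofReal (logWeight r ^ α) * ‖geomPoly n r - 1‖ₑ) := by
  have hβ : 0 < α + 1 := by linarith
  have hl4 : 0 < Real.log 4 := Real.log_pos (by norm_num)
  -- The term log(4)^(α+1) is lost at the lower endpoint r = 1/2 and also covers n < 2; 4(α+1)
  -- inverts the factor 1/(4(α+1)) of the integral.
  set B : ℝ := 1 + Real.log 4 ^ (α + 1) + 4 * (α + 1) with hB
  have hB0 : 0 < B := by positivity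
  refine ⟨2 ^ (α + 1) * B, by positivity, fun n => ?_⟩
  have h2β : (1 : ℝ) ≤ 2 ^ (α + 1) := Real.one_le_rpow one_le_two hβ.le
  rcases lt_or_ge n 2 with hn | hn
  · refine le_trans ?_ (mul_le_mul_right le_self_add _)
    rw [mul_one]
    refine ENNReal.ofReal_le_ofReal ?_
    have hn' : (n : ℝ) ≤ 1 := by exact_mod_cast Nat.lt_succ_iff.1 hn
    have hn0 : (0 : ℝ) ≤ n := n.cast_nonneg
    have h1 : Real.log (n + 2) ^ (α + 1) ≤ Real.log 4 ^ (α + 1) :=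
      Real.rpow_le_rpow (Real.log_nonneg (by linarith))
        (Real.log_le_log (by linarith) (by linarith)) hβ.le
    have h2 : Real.log 4 ^ (α + 1) ≤ B := by linarith
    nlinarith
  · have hn' : (2 : ℝ) ≤ n := by exact_mod_cast hn
    have hinv : 1 / (n : ℝ) ≤ 1 / 2 := one_div_le_one_div_of_le two_pos hn'
    have hs : (1 : ℝ) / 2 ≤ 1 - 1 / n := by linarith
    have hs1 : 1 - 1 / (n : ℝ) < 1 := sub_lt_self _ (by positivity)
    set D : ℝ := Real.log (2 * n) ^ (α + 1) - Real.log 4 ^ (α + 1) with hD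
    have hD0 : 0 ≤ D := sub_nonneg.2 (Real.rpow_le_rpow hl4.le
      (Real.log_le_log (by norm_num) (by linarith)) hβ.le)
    have hint : ENNReal.ofReal (1 / 4 / (α + 1) * D) ≤
        ∫⁻ r in Ioo (0 : ℝ) 1, ENNReal.ofReal (logWeight r ^ α) * ‖geomPoly n r - 1‖ₑ := by
      have h1 := lintegral_logWeight_rpow_div hα (by norm_num) hs hs1
        (show (0 : ℝ) ≤ 1 / 4 by norm_num)
      have h2 : logWeight (1 / 2) = Real.log 4 := by
        rw [logWeight]
        norm_num
      rw [logWeight_one_sub_inv, h2, ← hD] at h1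
      rw [← h1]
      refine le_trans (setLIntegral_mono' measurableSet_Ioo fun r hr => ?_)
        (lintegral_mono_set (Ioo_subset_Ioo (by norm_num : (0 : ℝ) ≤ 1 / 2) hs1.le))
      have hr0 : 0 ≤ r := by linarith [hr.1]
      have hw := logWeight_pos hr0 (hr.2.trans hs1)
      rw [enorm_geomPoly_sub_one n hr0, ← ENNReal.ofReal_mul (by positivity)]
      refine ENNReal.ofReal_le_ofReal ?_
      have h3 := inv_le_sum_pow_sub_one (by omega : 0 < n) hr.1.le hr.2.le
      calc _ = logWeight r ^ α * (1 / 4 * (1 / (1 - r))) := by ring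
        _ ≤ _ := by gcongr
    refine le_trans ?_ (mul_le_mul_right (add_le_add_right hint 1) _)
    rw [← ENNReal.ofReal_one, ← ENNReal.ofReal_add zero_le_one (by positivity),
      ← ENNReal.ofReal_mul (by positivity)]
    refine ENNReal.ofReal_le_ofReal ?_
    have h1 : Real.log (n + 2) ^ (α + 1) ≤ 2 ^ (α + 1) * Real.log (2 * n) ^ (α + 1) := by
      rw [← Real.mul_rpow zero_le_two (Real.log_nonneg (by linarith))]
      refine Real.rpow_le_rpow (Real.log_nonneg (by linarith)) ?_ hβ.le
      have h2 : Real.log (n + 2) ≤ Real.log (2 * n) :=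
        Real.log_le_log (by linarith) (by linarith)
      have h3 : 0 ≤ Real.log (2 * n) := Real.log_nonneg (by linarith)
      linarith
    rw [mul_assoc]
    refine h1.trans (mul_le_mul_of_nonneg_left ?_ (by positivity))
    have h4 : 4 * (α + 1) * (1 / 4 / (α + 1) * D) = D := by
      field_simp
    have h5 : 0 ≤ 1 / 4 / (α + 1) * D := by positivity
    have h6 : 0 < Real.log 4 ^ (α + 1) := by positivity
    have h7 : Real.log (2 * n) ^ (α + 1) = D + Real.log 4 ^ (α + 1) := by rw [hD]; ring
    rw [h7]
    nlinarith [mul_nonneg h5 h6.le]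

/-! ### Norm estimates for series of geometric polynomials -/

theorem bloch1Norm_eq (α : ℝ) (f : ℂ → ℂ) : bloch1Norm α f =
    ‖f 0‖ₑ + ∫⁻ z, ‖deriv f z‖ₑ * ENNReal.ofReal (logWeight ‖z‖ ^ α) ∂diskArea := rfl

theorem ae_mem_unitDisk : ∀ᵐ z ∂diskArea, z ∈ unitDisk :=
  Measure.ae_smul_measure (ae_restrict_mem isOpen_unitDisk.measurableSet) _

/-- The values of `libera` outside the disk carry no meaning. The measure lives on the open disk,
where the derivative is determined by the values inside. -/
theorem bloch1Norm_congr {α : ℝ} {f₁ f₂ : ℂ → ℂ} (h : EqOn f₁ f₂ unitDisk) :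
    bloch1Norm α f₁ = bloch1Norm α f₂ := by
  rw [bloch1Norm_eq, bloch1Norm_eq, h (by simp [mem_unitDisk])]
  congr 1
  refine lintegral_congr_ae ?_
  filter_upwards [ae_mem_unitDisk] with z hz
  rw [(h.eventuallyEq_of_mem (isOpen_unitDisk.mem_nhds hz)).deriv_eq]

theorem measurable_logWeight : Measurable logWeight := by
  unfold logWeight
  fun_prop

variable {c : ℕ → ℝ}

theorem enorm_geomSeries_zero (h0 : ∀ n, 0 ≤ c n) (hs : Summable c) :
    ‖geomSeries c 0‖ₑ = ∑' n, ENNReal.ofReal (c n) := by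
  have h1 : geomSeries c 0 = ((∑' n, c n : ℝ) : ℂ) := by
    simp [geomSeries, geomPoly_zero_right, Complex.ofReal_tsum]
  rw [h1, ← ofReal_norm, Complex.norm_real, Real.norm_of_nonneg (tsum_nonneg h0),
    ENNReal.ofReal_tsum_of_nonneg h0 hs]

theorem enorm_geomSeries_sub (h0 : ∀ n, 0 ≤ c n) (hs : Summable c) {r : ℝ} (hr0 : 0 ≤ r)
    (hr1 : r < 1) : ‖geomSeries c r - geomSeries c 0‖ₑ =
      ∑' n, ENNReal.ofReal (c n) * ‖geomPoly n r - 1‖ₑ := by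
  have hr : ‖(r : ℂ)‖ < 1 := by simpa [abs_of_nonneg hr0] using hr1
  have hsum := (summable_geomSeries h0 hs hr).sub (summable_geomSeries h0 hs (z := 0) (by simp))
  have hterm : ∀ n, (c n : ℂ) * geomPoly n r - (c n : ℂ) * geomPoly n 0 =
      ((c n * (∑ k ∈ Finset.range (n + 1), r ^ k - 1) : ℝ) : ℂ) := fun n => by
    rw [geomPoly_zero_right, geomPoly_ofReal]
    push_cast
    ring
  have hnn : ∀ n, 0 ≤ c n * (∑ k ∈ Finset.range (n + 1), r ^ k - 1) := fun n =>
    mul_nonneg (h0 n) (sub_nonneg.2 (one_le_sum_pow n hr0))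
  simp_rw [hterm] at hsum
  have hsum' := Complex.summable_ofReal.1 hsum
  rw [geomSeries, geomSeries, ← (summable_geomSeries h0 hs hr).tsum_sub
    (summable_geomSeries h0 hs (z := 0) (by simp))]
  simp_rw [hterm, enorm_geomPoly_sub_one _ hr0]
  rw [← Complex.ofReal_tsum, ← ofReal_norm, Complex.norm_real,
    Real.norm_of_nonneg (tsum_nonneg hnn), ENNReal.ofReal_tsum_of_nonneg hnn hsum']
  exact tsum_congr fun n => ENNReal.ofReal_mul (h0 n)

/-- The factor r in the Hardy-type inequality is precisely the polar Jacobian; the factor π undoes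
the normalization of area. -/
theorem lintegral_enorm_sub_le {α : ℝ} {f : ℂ → ℂ} (hf : DifferentiableOn ℂ f unitDisk) :
    ∫⁻ r in Ioo (0 : ℝ) 1, ENNReal.ofReal (logWeight r ^ α) * ‖f r - f 0‖ₑ ≤
      ENNReal.ofReal Real.pi *
        ∫⁻ z, ‖deriv f z‖ₑ * ENNReal.ofReal (logWeight ‖z‖ ^ α) ∂diskArea := by
  have hmeas : Measurable fun z : ℂ => ‖deriv f z‖ₑ * ENNReal.ofReal (logWeight ‖z‖ ^ α) := by
    have := measurable_deriv f
    have := measurable_logWeight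
    fun_prop
  have hpi : ENNReal.ofReal Real.pi ≠ 0 := by simpa using Real.pi_pos
  rw [lintegral_diskArea hmeas, ← mul_assoc, ENNReal.mul_inv_cancel hpi ENNReal.ofReal_ne_top,
    one_mul]
  refine setLIntegral_mono' measurableSet_Ioo fun r hr => ?_
  simp_rw [norm_circleMap_zero, abs_of_pos hr.1]
  rw [lintegral_mul_const' _ _ ENNReal.ofReal_ne_top, ← mul_assoc, mul_comm]
  refine mul_le_mul_left ?_ _
  refine le_trans ?_ (two_mul_enorm_sub_le hf hr.1 hr.2)
  rw [two_mul]
  exact le_self_add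

/-- In the lower estimate for G_n the summand 1 adds up to |f(0)|, and the integrals add up, by
Tonelli, to the integral of |f(r) - f(0)|. -/
theorem exists_tsum_le_bloch1Norm {α : ℝ} (hα : -1 < α) : ∃ C : ℝ, 0 < C ∧ ∀ c : ℕ → ℝ,
    (∀ n, 0 ≤ c n) → Summable c →
      ∑' n : ℕ, ENNReal.ofReal (c n * Real.log (n + 2) ^ (α + 1)) ≤
        ENNReal.ofReal C * bloch1Norm α (geomSeries c) := by
  obtain ⟨A, hA, hlow⟩ := exists_log_rpow_le_lintegral hα
  refine ⟨A * Real.pi, mul_pos hA Real.pi_pos, fun c h0 hs => ?_⟩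
  set M : ℕ → ℝ≥0∞ := fun n =>
    ∫⁻ r in Ioo (0 : ℝ) 1, ENNReal.ofReal (logWeight r ^ α) * ‖geomPoly n r - 1‖ₑ with hM
  have hS : ∫⁻ r in Ioo (0 : ℝ) 1,
      ENNReal.ofReal (logWeight r ^ α) * ‖geomSeries c r - geomSeries c 0‖ₑ =
      ∑' n, ENNReal.ofReal (c n) * M n := by
    have hm : ∀ n, Measurable fun r : ℝ =>
        ENNReal.ofReal (c n) * (ENNReal.ofReal (logWeight r ^ α) * ‖geomPoly n r - 1‖ₑ) :=
      fun n => by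
        have h1 := measurable_logWeight
        have h2 : Measurable fun r : ℝ => geomPoly n r :=
          (differentiable_geomPoly n).continuous.measurable.comp Complex.measurable_ofReal
        fun_prop
    simp_rw [hM, ← lintegral_const_mul' _ _ ENNReal.ofReal_ne_top]
    rw [← lintegral_tsum fun n => (hm n).aemeasurable]
    refine setLIntegral_congr_fun measurableSet_Ioo fun r hr => ?_
    rw [enorm_geomSeries_sub h0 hs hr.1.le hr.2, ← ENNReal.tsum_mul_left]
    exact tsum_congr fun n => mul_left_comm _ _ _
  have hI := lintegral_enorm_sub_le (α := α) (differentiableOn_geomSeries h0 hs)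
  rw [hS] at hI
  calc _ ≤ ∑' n : ℕ, ENNReal.ofReal A * (ENNReal.ofReal (c n) +
        ENNReal.ofReal (c n) * M n) := by
        refine ENNReal.tsum_le_tsum fun n => ?_
        rw [ENNReal.ofReal_mul (h0 n)]
        calc _ ≤ ENNReal.ofReal (c n) * (ENNReal.ofReal A * (1 + M n)) := by
              gcongr
              exact hlow n
          _ = _ := by ring
    _ = ENNReal.ofReal A * (‖geomSeries c 0‖ₑ + ∑' n, ENNReal.ofReal (c n) * M n) := by
        rw [ENNReal.tsum_mul_left, ENNReal.tsum_add, enorm_geomSeries_zero h0 hs]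
    _ ≤ ENNReal.ofReal A * (ENNReal.ofReal Real.pi * ‖geomSeries c 0‖ₑ + ENNReal.ofReal Real.pi *
        ∫⁻ z, ‖deriv (geomSeries c) z‖ₑ * ENNReal.ofReal (logWeight ‖z‖ ^ α) ∂diskArea) := by
        gcongr
        refine le_mul_of_one_le_left' (ENNReal.one_le_ofReal.2 ?_)
        linarith [Real.pi_gt_three]
    _ = _ := by
        rw [bloch1Norm_eq, ENNReal.ofReal_mul hA.le, ← mul_add, mul_assoc]

/-- From log(n+2) ≥ log 2 > 0. It bounds |f(0)| in the upper estimate and gives summability of c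
when K_α(g) is finite. -/
theorem exists_tsum_ofReal_le {β : ℝ} (hβ : 0 < β) : ∃ C : ℝ, 0 < C ∧ ∀ c : ℕ → ℝ,
    (∀ n, 0 ≤ c n) → ∑' n, ENNReal.ofReal (c n) ≤
      ENNReal.ofReal C * ∑' n : ℕ, ENNReal.ofReal (c n * Real.log (n + 2) ^ β) := by
  have hl2 : 0 < Real.log 2 := Real.log_pos one_lt_two
  refine ⟨(Real.log 2 ^ β)⁻¹, by positivity, fun c h0 => ?_⟩
  rw [← ENNReal.tsum_mul_left]
  refine ENNReal.tsum_le_tsum fun n => ?_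
  rw [← ENNReal.ofReal_mul (by positivity)]
  refine ENNReal.ofReal_le_ofReal ?_
  have hn : (0 : ℝ) ≤ n := n.cast_nonneg
  have h1 : Real.log 2 ^ β ≤ Real.log (n + 2) ^ β :=
    Real.rpow_le_rpow hl2.le (Real.log_le_log two_pos (by linarith)) hβ.le
  rw [inv_mul_eq_div, le_div_iff₀ (by positivity)]
  exact mul_le_mul_of_nonneg_left h1 (h0 n)

theorem exists_bloch1Norm_le_tsum {α : ℝ} (hα : -1 < α) : ∃ C : ℝ, 0 < C ∧ ∀ c : ℕ → ℝ,
    (∀ n, 0 ≤ c n) → Summable c → bloch1Norm α (geomSeries c) ≤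
      ENNReal.ofReal C * ∑' n : ℕ, ENNReal.ofReal (c n * Real.log (n + 2) ^ (α + 1)) := by
  obtain ⟨K, hK, hup⟩ := exists_lintegral_deriv_geomPoly_le hα
  obtain ⟨C, hC, hzero⟩ := exists_tsum_ofReal_le (by linarith : 0 < α + 1)
  refine ⟨C + K, add_pos hC hK, fun c h0 hs => ?_⟩
  rw [bloch1Norm_eq, enorm_geomSeries_zero h0 hs, ENNReal.ofReal_add hC.le hK.le, add_mul]
  refine add_le_add (hzero c h0) ?_
  have hm : ∀ n, Measurable fun z : ℂ => ENNReal.ofReal (c n) *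
      (‖deriv (geomPoly n) z‖ₑ * ENNReal.ofReal (logWeight ‖z‖ ^ α)) := fun n => by
    have h1 := measurable_deriv (geomPoly n)
    have h2 := measurable_logWeight
    fun_prop
  calc _ ≤ ∫⁻ z, ∑' n, ENNReal.ofReal (c n) *
        (‖deriv (geomPoly n) z‖ₑ * ENNReal.ofReal (logWeight ‖z‖ ^ α)) ∂diskArea := by
        refine lintegral_mono_ae ?_
        filter_upwards [ae_mem_unitDisk] with z hz
        simp_rw [← mul_assoc]
        rw [ENNReal.tsum_mul_right,
          ← (hasSum_deriv_geomSeries h0 hs (mem_unitDisk.1 hz)).tsum_eq]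
        refine mul_le_mul_left (enorm_tsum_le_tsum_enorm.trans (le_of_eq ?_)) _
        refine tsum_congr fun n => ?_
        rw [enorm_mul, ← ofReal_norm (c n : ℂ), Complex.norm_real, Real.norm_of_nonneg (h0 n)]
    _ = ∑' n, ENNReal.ofReal (c n) *
        ∫⁻ z, ‖deriv (geomPoly n) z‖ₑ * ENNReal.ofReal (logWeight ‖z‖ ^ α) ∂diskArea := by
        rw [lintegral_tsum fun n => (hm n).aemeasurable]
        exact tsum_congr fun n => lintegral_const_mul' _ _ ENNReal.ofReal_ne_top
    _ ≤ ∑' n : ℕ, ENNReal.ofReal K * ENNReal.ofReal (c n * Real.log (n + 2) ^ (α + 1)) := by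
        refine ENNReal.tsum_le_tsum fun n => ?_
        refine (mul_le_mul_right (hup n) _).trans (le_of_eq ?_)
        rw [← ENNReal.ofReal_mul (h0 n), ← ENNReal.ofReal_mul hK.le]
        congr 1
        ring
    _ = _ := ENNReal.tsum_mul_left

theorem summable_of_tsum_ofReal_lt_top (h0 : ∀ n, 0 ≤ c n)
    (h : ∑' n, ENNReal.ofReal (c n) < ⊤) : Summable c := by
  have := ENNReal.summable_toReal h.ne
  simpa only [ENNReal.toReal_ofReal (h0 _)] using this

theorem coeffSum_eq (α : ℝ) (g : ℂ → ℂ) : coeffSum α g = ∑' n : ℕ,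
    ENNReal.ofReal ((taylorCoeff g n).re / (n + 1) * Real.log (n + 2) ^ (α + 1)) := by
  refine tsum_congr fun n => ?_
  congr 1
  ring

end LogBloch

/-! ### Membership criterion and two-sided estimate -/

theorem mainTheorem3 (α : ℝ) (hα : -1 < α) :
    ∃ C : ℝ, 0 < C ∧ ∀ g : ℂ → ℂ, AnalyticOnNhd ℂ g LogBloch.unitDisk →
      (∀ n : ℕ, (LogBloch.taylorCoeff g n).im = 0 ∧ 0 ≤ (LogBloch.taylorCoeff g n).re) →
      ((LogBloch.LiberaExists g ∧ LogBloch.MemBloch1 α (LogBloch.libera g)) ↔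
          LogBloch.coeffSum α g < ⊤) ∧
        (LogBloch.LiberaExists g →
          LogBloch.coeffSum α g / ENNReal.ofReal C ≤ LogBloch.bloch1Norm α (LogBloch.libera g) ∧
          LogBloch.bloch1Norm α (LogBloch.libera g) ≤
            ENNReal.ofReal C * LogBloch.coeffSum α g) := by
  obtain ⟨C₁, hC₁, hlow⟩ := LogBloch.exists_tsum_le_bloch1Norm hα
  obtain ⟨C₂, hC₂, hup⟩ := LogBloch.exists_bloch1Norm_le_tsum hα
  obtain ⟨C₃, hC₃, hsum⟩ := LogBloch.exists_tsum_ofReal_le (by linarith : 0 < α + 1)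
  refine ⟨max C₁ C₂, lt_max_of_lt_left hC₁, fun g hg hcoeff => ?_⟩
  have hprim := LogBloch.isPrimitiveCoeff_taylorCoeff hg hcoeff
  set c : ℕ → ℝ := fun n => (LogBloch.taylorCoeff g n).re / (n + 1) with hc
  have hK : LogBloch.coeffSum α g =
      ∑' n : ℕ, ENNReal.ofReal (c n * Real.log (n + 2) ^ (α + 1)) := LogBloch.coeffSum_eq α g
  have hest : LogBloch.LiberaExists g →
      LogBloch.coeffSum α g ≤
        ENNReal.ofReal (max C₁ C₂) * LogBloch.bloch1Norm α (LogBloch.libera g) ∧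
      LogBloch.bloch1Norm α (LogBloch.libera g) ≤
        ENNReal.ofReal (max C₁ C₂) * LogBloch.coeffSum α g := fun hL => by
    have hs := hprim.liberaExists_iff_summable.1 hL
    rw [LogBloch.bloch1Norm_congr (hprim.libera_eq_geomSeries hs), hK]
    refine ⟨(hlow c hprim.nonneg hs).trans ?_, (hup c hprim.nonneg hs).trans ?_⟩
    · gcongr
      exact le_max_left _ _
    · gcongr
      exact le_max_right _ _
  refine ⟨⟨fun h => ?_, fun h => ?_⟩, fun hL => ⟨?_, (hest hL).2⟩⟩
  · exact (hest h.1).1.trans_lt (ENNReal.mul_lt_top ENNReal.ofReal_lt_top h.2.2)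
  -- Finiteness of K_α(g) must first yield existence of the transform, as the norm estimates
  -- presuppose it.
  · have hs : Summable c := by
      refine LogBloch.summable_of_tsum_ofReal_lt_top hprim.nonneg ?_
      rw [hK] at h
      exact (hsum c hprim.nonneg).trans_lt (ENNReal.mul_lt_top ENNReal.ofReal_lt_top h)
    have hL := hprim.liberaExists_iff_summable.2 hs
    refine ⟨hL, ?_, (hest hL).2.trans_lt (ENNReal.mul_lt_top ENNReal.ofReal_lt_top h)⟩
    exact ((LogBloch.differentiableOn_geomSeries hprim.nonneg hs).congr
      (hprim.libera_eq_geomSeries hs)).analyticOnNhd LogBloch.isOpen_unitDisk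
  · exact ENNReal.div_le_of_le_mul' (hest hL).1
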